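/- There is an absolute constant $c>0$ such that the following holds. Let $Z\in\mathbb{R}^{d\times r}$ with rows $z_1,\dots,z_d$ be such that $ZZ^T$ has rank exactly $r$ and $\sigma_{\max}(Z)=1$. Let $\kappa=\lambda_{\max}(Z^TZ)/\lambda_{\min}(Z^TZ)$ be the condition number and $\mu=\frac{d}{r}\max_{1\le i\le d}\|e_i^TZ(Z^TZ)^{-1/2}\|^2$ the coherence of the ground truth $ZZ^T$. For $X\in\mathbb{R}^{d\times r}$ put $f(X)=\|XX^T-ZZ^T\|_F^2$ and $g_i(X)=e_i^TX(X^TX)^{-1}X^Te_i$. Select a radius $0\le\rho<1/2$ and set $$f_{\max}=\Big(\frac{\rho}{\kappa}\Big)^2,\qquad g_{\max}=\frac{2^4}{(1-2\rho)^2}\cdot\frac{\mu r}{d}.$$ Let $X_0\in\mathbb{R}^{d\times r}$ satisfy $f(X_0)\le\frac12 f_{\max}$ and $\max_i g_i(X_0)\le\frac12 g_{\max}$. Let $(i_0,j_0),(i_1,j_1),\dots$ be independent and uniformly distributed on $\{1,\dots,d\}^2$, and let the ScaledSGD iterates be $$X_{t+1}=X_t-\alpha\,SG_t(X_t)\,(X_t^TX_t)^{-1},\qquad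 SG_t(X)=2d^2\,(x_{i_t}^Tx_{j_t}-z_{i_t}^Tz_{j_t})\,(e_{i_t}x_{j_t}^T+e_{j_t}x_{i_t}^T),$$ where $x_k$ denotes the $k$-th row of $X$ (as a column vector). Then for every step size $\alpha>0$ with $\alpha\,(g_{\max}+\rho)\,d^2\log d<c$ and every integer $T\ge0$, with probability at least $1-T/d^{10}$, for all $t\le T$, $$f(X_t)\le\Big(1-\frac{\alpha}{2}\Big)^t f_{\max}\qquad\text{and}\qquad\max_i g_i(X_t)\le g_{\max}.$$ In particular, the contraction factor $1-\alpha/2$ and the constant $c$ do not depend on $\kappa$. -/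

import Mathlib

open MeasureTheory ProbabilityTheory
open scoped Matrix

namespace ScaledSGD

noncomputable section

/-- The largest singular value `σ_max(Z)` of a real matrix. -/
def sigmaMax {d r : ℕ} (Z : Matrix (Fin d) (Fin r) ℝ) : ℝ :=
  (Matrix.toEuclideanLin Z).singularValues 0

/-- The largest eigenvalue of `Zᵀ Z`. -/
def gramMax {d r : ℕ} (Z : Matrix (Fin d) (Fin r) ℝ) : ℝ :=
  ⨆ k : Fin r, (Matrix.isHermitian_conjTranspose_mul_self Z).eigenvalues k

/-- The smallest eigenvalue of `Zᵀ Z`. -/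
def gramMin {d r : ℕ} (Z : Matrix (Fin d) (Fin r) ℝ) : ℝ :=
  ⨅ k : Fin r, (Matrix.isHermitian_conjTranspose_mul_self Z).eigenvalues k

/-- The condition number `κ = λ_max(Zᵀ Z) / λ_min(Zᵀ Z)`. -/
def kappa {d r : ℕ} (Z : Matrix (Fin d) (Fin r) ℝ) : ℝ :=
  gramMax Z / gramMin Z

section SquareRoot

open scoped MatrixOrder

/-- The matrix `Z (Zᵀ Z)^{-1/2}`. -/
def whiten {d r : ℕ} (Z : Matrix (Fin d) (Fin r) ℝ) : Matrix (Fin d) (Fin r) ℝ :=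
  Z * (CFC.sqrt (Zᵀ * Z))⁻¹

end SquareRoot

/-- The coherence `μ = (d / r) · max_i ‖e_iᵀ Z (Zᵀ Z)^{-1/2}‖²`. -/
def coherence {d r : ℕ} (Z : Matrix (Fin d) (Fin r) ℝ) : ℝ :=
  ((d : ℝ) / (r : ℝ)) * ⨆ i : Fin d, ‖WithLp.toLp 2 (whiten Z i)‖ ^ 2

section FrobeniusNorm

attribute [local instance] Matrix.frobeniusNormedAddCommGroup

/-- The objective `f(X) = ‖X Xᵀ - Z Zᵀ‖_F²`. -/
def f {d r : ℕ} (Z X : Matrix (Fin d) (Fin r) ℝ) : ℝ :=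
  ‖X * Xᵀ - Z * Zᵀ‖ ^ 2

/-- The objective as a sum of squared entries. -/
lemma f_eq_sum {d r : ℕ} (Z X : Matrix (Fin d) (Fin r) ℝ) :
    f Z X = ∑ i, ∑ j, ((X * Xᵀ - Z * Zᵀ) i j) ^ 2 := by
  have h : 0 ≤ ∑ i, ∑ j, ((X * Xᵀ - Z * Zᵀ) i j) ^ 2 :=
    Finset.sum_nonneg fun i _ => Finset.sum_nonneg fun j _ => sq_nonneg _
  rw [f, Matrix.frobenius_norm_def, ← Real.sqrt_eq_rpow]
  simp only [Real.rpow_two, Real.norm_eq_abs, sq_abs]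
  exact Real.sq_sqrt h

end FrobeniusNorm

/-- The coherence function `g_i(X) = e_iᵀ X (Xᵀ X)⁻¹ Xᵀ e_i`. -/
def g {d r : ℕ} (X : Matrix (Fin d) (Fin r) ℝ) (i : Fin d) : ℝ :=
  (X * (Xᵀ * X)⁻¹ * Xᵀ) i i

/-- `‖e_iᵀ Z (Zᵀ Z)^{-1/2}‖² = g_i(Z)`. -/
lemma norm_whiten_sq {d r : ℕ} (Z : Matrix (Fin d) (Fin r) ℝ) (i : Fin d) :
    ‖WithLp.toLp 2 (whiten Z i)‖ ^ 2 = g Z i := by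
  open scoped MatrixOrder in
  have h0 : (0 : Matrix (Fin r) (Fin r) ℝ) ≤ Zᵀ * Z :=
    Matrix.nonneg_iff_posSemidef.mpr (Matrix.posSemidef_conjTranspose_mul_self Z)
  open scoped MatrixOrder in
  have hsq : CFC.sqrt (Zᵀ * Z) * CFC.sqrt (Zᵀ * Z) = Zᵀ * Z :=
    CFC.sqrt_mul_sqrt_self (Zᵀ * Z) h0
  open scoped MatrixOrder in
  have hsym : (CFC.sqrt (Zᵀ * Z))ᵀ = CFC.sqrt (Zᵀ * Z) :=
    (Matrix.nonneg_iff_posSemidef.mp (CFC.sqrt_nonneg (Zᵀ * Z))).1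
  have key : whiten Z * (whiten Z)ᵀ = Z * (Zᵀ * Z)⁻¹ * Zᵀ := by
    rw [whiten, Matrix.transpose_mul, Matrix.transpose_nonsing_inv, hsym, ← Matrix.mul_assoc,
      Matrix.mul_assoc Z, ← Matrix.mul_inv_rev, hsq]
  rw [g, ← key, EuclideanSpace.norm_sq_eq, Matrix.mul_apply]
  exact Finset.sum_congr rfl fun k _ => by
    simp [sq]

/-- The radius `f_max = (ρ / κ)²`. -/
def fMax {d r : ℕ} (Z : Matrix (Fin d) (Fin r) ℝ) (ρ : ℝ) : ℝ :=
  (ρ / kappa Z) ^ 2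

/-- The coherence level `g_max = 2⁴ / (1 - 2ρ)² · μ r / d`. -/
def gMax {d r : ℕ} (Z : Matrix (Fin d) (Fin r) ℝ) (ρ : ℝ) : ℝ :=
  2 ^ 4 / (1 - 2 * ρ) ^ 2 * (coherence Z * (r : ℝ) / (d : ℝ))

/-- The stochastic gradient for the sampled index pair `p = (i, j)`:
`2 d² (x_iᵀ x_j - z_iᵀ z_j) (e_i x_jᵀ + e_j x_iᵀ)`, where `x_k`, `z_k` are the rows. -/
def stochGrad {d r : ℕ} (Z X : Matrix (Fin d) (Fin r) ℝ) (p : Fin d × Fin d) :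
    Matrix (Fin d) (Fin r) ℝ :=
  (2 * (d : ℝ) ^ 2 * (X p.1 ⬝ᵥ X p.2 - Z p.1 ⬝ᵥ Z p.2)) •
    (Matrix.vecMulVec (Pi.single p.1 1) (X p.2) + Matrix.vecMulVec (Pi.single p.2 1) (X p.1))

/-- The ScaledSGD iterates `X_{t+1} = X_t - α SG(X_t) (X_tᵀ X_t)⁻¹`, where `s t` is the index pair
sampled at step `t`. -/
def iterate {d r : ℕ} (Z : Matrix (Fin d) (Fin r) ℝ) (α : ℝ) (X₀ : Matrix (Fin d) (Fin r) ℝ)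
    (s : ℕ → Fin d × Fin d) : ℕ → Matrix (Fin d) (Fin r) ℝ
  | 0 => X₀
  | t + 1 => iterate Z α X₀ s t - α •
      (stochGrad Z (iterate Z α X₀ s t) (s t) *
        ((iterate Z α X₀ s t)ᵀ * iterate Z α X₀ s t)⁻¹)

end

end ScaledSGD

/-!
Write `E = X Xᵀ - Z Zᵀ`, let `P` be the projection onto the column space of `X`, let `R` be the
pseudo-inverse of `X Xᵀ`, and for the sampled pair `(k, l)` put `J = e_k e_lᵀ + e_l e_kᵀ` and
`η = 2 α d² E_{kl}`. One step of ScaledSGD is `X ↦ (1 - η J R) X`. Throughout, `lam = 1 / κ`, which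
is at most `λ_min(Zᵀ Z)` because `λ_max(Zᵀ Z) = 1`, so that `f(X) ≤ f_max` reads
`‖E‖_F ≤ ρ lam`; this forces `λ_min(Xᵀ X) ≥ (1 - ρ) lam` (`bddBelowBy_of_f_le`). All bounds below
are relative to `lam`, which is why no condition number appears in them.

*The objective.* The next error is `E - η (J P + P J) + η² J R J`. Its squared norm drops on average
by `16 α ‖P E‖_F²`, and `‖P E‖_F² ≥ f / 3` (`f_le_three_mul_frob`), since the block
`(1 - P) E (1 - P)` is of second order. The entries of `E` are at most `2 √(g_max f)`, so the
relative fluctuation of `f` is of order `α d² g_max ≲ 1 / log d`, with variance of order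
`α · α d² g_max`. Hence for `n ≲ log d` the moment `f ^ n` contracts by `(1 - α / 2) ^ n` on average
(`NearTruth.sum_f_update_pow_le`). As `f` starts a factor `2` below its level, Markov's inequality
gives a failure probability `2⁻ⁿ ≤ d⁻¹²` at each time.

*The coherence.* If `n` is orthogonal to the columns of the next iterate, then `g_i` of that iterate
is at most `‖e_i - n‖²`. Solving `n = (1 - P) e_i + η R J n` gives such a vector, and bounds the
change of `g_i` by an explicit first-order term and a second-order remainder
(`NearTruth.g_update_le`). The mean of the first-order term pulls `g_i` towards values below
`g_max / 16` (`neg_dotProduct_err_le`), and the noise has variance of order `α² d² f / lam²` relative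
to `g_max²`. So `exp (θ (g_i / g_max - 1 / 16))` with `θ = 32 log d` relaxes towards `1` on average,
up to a factor `1 + O(θ² α² d² f / lam²)` (`NearTruth.sum_cohPot_update_le`). While the bounds hold,
`f` decays geometrically, so these factors have a bounded product, at most a small power of `d`; this
uses the term `ρ` in the step-size condition. Since `g_i` starts below `g_max / 2`, each row fails
with probability at most `d⁻¹³` at each time.

Both averaged inequalities are only valid while the bounds hold, so the potentials are killed at the
first failure (`stopped`, `integral_stopped_succ_le`), and a union bound over the time of the first
failure, and over the rows, concludes.
-/

namespace ScaledSGD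

/-! ### Euclidean norms of coordinate vectors -/

/-- The Euclidean norm of a coordinate vector. -/
noncomputable def nrm {n : ℕ} (v : Fin n → ℝ) : ℝ := ‖WithLp.toLp 2 v‖

section Norm

variable {n m : ℕ}

lemma nrm_nonneg (v : Fin n → ℝ) : 0 ≤ nrm v := norm_nonneg _

lemma nrm_sq (v : Fin n → ℝ) : nrm v ^ 2 = v ⬝ᵥ v := by
  rw [nrm, EuclideanSpace.norm_sq_eq]
  simp [dotProduct, sq]

lemma nrm_sq_eq_sum (v : Fin n → ℝ) : nrm v ^ 2 = ∑ i, v i ^ 2 := by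
  rw [nrm_sq]; simp [dotProduct, sq]

lemma abs_dotProduct_le (v w : Fin n → ℝ) : |v ⬝ᵥ w| ≤ nrm v * nrm w := by
  have := abs_real_inner_le_norm (WithLp.toLp 2 w) (WithLp.toLp 2 v)
  rw [EuclideanSpace.inner_toLp_toLp] at this
  simpa [nrm, mul_comm] using this

lemma nrm_add_le (v w : Fin n → ℝ) : nrm (v + w) ≤ nrm v + nrm w := by
  simpa [nrm] using norm_add_le (WithLp.toLp 2 v) (WithLp.toLp 2 w)

lemma nrm_sub_le (v w : Fin n → ℝ) : nrm (v - w) ≤ nrm v + nrm w := by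
  simpa [nrm] using norm_sub_le (WithLp.toLp 2 v) (WithLp.toLp 2 w)

lemma nrm_smul (c : ℝ) (v : Fin n → ℝ) : nrm (c • v) = |c| * nrm v := by
  simp [nrm, norm_smul]

lemma nrm_eq_zero {v : Fin n → ℝ} : nrm v = 0 ↔ v = 0 := by
  simp [nrm]

lemma nrm_single (i : Fin n) : nrm (Pi.single i 1 : Fin n → ℝ) = 1 := by
  have h := nrm_sq (Pi.single i 1 : Fin n → ℝ)
  have h0 := nrm_nonneg (Pi.single i 1 : Fin n → ℝ)
  simp only [single_one_dotProduct, Pi.single_eq_same] at h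
  nlinarith

lemma abs_apply_le_nrm (v : Fin n → ℝ) (i : Fin n) : |v i| ≤ nrm v := by
  simpa [nrm_single] using abs_dotProduct_le (Pi.single i 1) v

lemma dotProduct_mulVec_transpose (A : Matrix (Fin n) (Fin m) ℝ) (v : Fin n → ℝ)
    (w : Fin m → ℝ) : (Aᵀ *ᵥ v) ⬝ᵥ w = v ⬝ᵥ (A *ᵥ w) := by
  rw [Matrix.mulVec_transpose, ← Matrix.dotProduct_mulVec]

/-- The squared Frobenius norm of a matrix. -/
def frob (A : Matrix (Fin n) (Fin m) ℝ) : ℝ := ∑ i, ∑ j, A i j ^ 2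

lemma frob_nonneg (A : Matrix (Fin n) (Fin m) ℝ) : 0 ≤ frob A :=
  Finset.sum_nonneg fun _ _ => Finset.sum_nonneg fun _ _ => sq_nonneg _

lemma frob_transpose (A : Matrix (Fin n) (Fin m) ℝ) : frob Aᵀ = frob A := by
  unfold frob; rw [Finset.sum_comm]; rfl

lemma frob_eq_sum_rows (A : Matrix (Fin n) (Fin m) ℝ) : frob A = ∑ i, nrm (A i) ^ 2 := by
  simp [frob, nrm_sq_eq_sum]

lemma frob_eq_sum_cols (A : Matrix (Fin n) (Fin m) ℝ) : frob A = ∑ j, nrm (A.col j) ^ 2 := by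
  rw [← frob_transpose, frob_eq_sum_rows]; rfl

lemma nrm_row_sq_le_frob (A : Matrix (Fin n) (Fin m) ℝ) (i : Fin n) : nrm (A i) ^ 2 ≤ frob A := by
  rw [frob_eq_sum_rows]
  exact Finset.single_le_sum (f := fun i => nrm (A i) ^ 2) (fun _ _ => sq_nonneg _)
    (Finset.mem_univ i)

lemma nrm_mulVec_le (A : Matrix (Fin n) (Fin m) ℝ) (v : Fin m → ℝ) :
    nrm (A *ᵥ v) ≤ √(frob A) * nrm v := by
  refine abs_le_of_sq_le_sq' ?_ (mul_nonneg (Real.sqrt_nonneg _) (nrm_nonneg _)) |>.2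
  rw [mul_pow, Real.sq_sqrt (frob_nonneg A), nrm_sq_eq_sum, frob_eq_sum_rows, Finset.sum_mul]
  refine Finset.sum_le_sum fun i _ => ?_
  have := abs_dotProduct_le (A i) v
  rw [← mul_pow, ← sq_abs]
  exact pow_le_pow_left₀ (abs_nonneg _) this 2

/-- The Frobenius inner product. -/
def frobInner (A B : Matrix (Fin n) (Fin m) ℝ) : ℝ := ∑ i, ∑ j, A i j * B i j

lemma frobInner_add_right (A B C : Matrix (Fin n) (Fin m) ℝ) :
    frobInner A (B + C) = frobInner A B + frobInner A C := by
  simp [frobInner, mul_add, Finset.sum_add_distrib]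

lemma frobInner_smul_right (A B : Matrix (Fin n) (Fin m) ℝ) (c : ℝ) :
    frobInner A (c • B) = c * frobInner A B := by
  simp only [frobInner, Finset.mul_sum, Matrix.smul_apply, smul_eq_mul]
  exact Finset.sum_congr rfl fun _ _ => Finset.sum_congr rfl fun _ _ => by ring

lemma frobInner_vecMulVec (A : Matrix (Fin n) (Fin m) ℝ) (v : Fin n → ℝ) (w : Fin m → ℝ) :
    frobInner A (Matrix.vecMulVec v w) = v ⬝ᵥ (A *ᵥ w) := by
  simp only [frobInner, Matrix.vecMulVec_apply, dotProduct, Matrix.mulVec, Finset.mul_sum]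
  exact Finset.sum_congr rfl fun _ _ => Finset.sum_congr rfl fun _ _ => by ring

lemma frob_add (A B : Matrix (Fin n) (Fin m) ℝ) :
    frob (A + B) = frob A + 2 * frobInner A B + frob B := by
  simp only [frob, frobInner, Finset.mul_sum, ← Finset.sum_add_distrib, Matrix.add_apply]
  exact Finset.sum_congr rfl fun _ _ => Finset.sum_congr rfl fun _ _ => by ring

lemma frob_vecMulVec (v : Fin n → ℝ) (w : Fin m → ℝ) :
    frob (Matrix.vecMulVec v w) = nrm v ^ 2 * nrm w ^ 2 := by
  simp only [frob, nrm_sq_eq_sum, Matrix.vecMulVec_apply, Finset.sum_mul, Finset.mul_sum, mul_pow]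
  rw [Finset.sum_comm]
  try rfl

lemma frobInner_sq_le (A B : Matrix (Fin n) (Fin m) ℝ) :
    frobInner A B ^ 2 ≤ frob A * frob B := by
  have h := Finset.sum_mul_sq_le_sq_mul_sq (Finset.univ : Finset (Fin n × Fin m))
    (fun p => A p.1 p.2) (fun p => B p.1 p.2)
  simpa only [frobInner, frob, Fintype.sum_prod_type] using h

lemma frob_smul (c : ℝ) (A : Matrix (Fin n) (Fin m) ℝ) : frob (c • A) = c ^ 2 * frob A := by
  simp [frob, Finset.mul_sum, mul_pow]

lemma frob_add_le (A B : Matrix (Fin n) (Fin m) ℝ) :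
    frob (A + B) ≤ 2 * frob A + 2 * frob B := by
  simp only [frob, Finset.mul_sum, ← Finset.sum_add_distrib, Matrix.add_apply]
  exact Finset.sum_le_sum fun i _ => Finset.sum_le_sum fun j _ => by
    nlinarith [sq_nonneg (A i j - B i j)]

end Norm

/-! ### The orthogonal projection onto the column space -/

section Proj

variable {d r : ℕ}

/-- The orthogonal projection `X (Xᵀ X)⁻¹ Xᵀ` onto the column space of `X`
(equal to `0` when `Xᵀ X` is singular). -/
noncomputable def proj (X : Matrix (Fin d) (Fin r) ℝ) : Matrix (Fin d) (Fin d) ℝ :=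
  X * (Xᵀ * X)⁻¹ * Xᵀ

lemma gram_inv_transpose (X : Matrix (Fin d) (Fin r) ℝ) : ((Xᵀ * X)⁻¹)ᵀ = (Xᵀ * X)⁻¹ := by
  rw [Matrix.transpose_nonsing_inv, Matrix.transpose_mul, Matrix.transpose_transpose]

lemma proj_transpose (X : Matrix (Fin d) (Fin r) ℝ) : (proj X)ᵀ = proj X := by
  simp only [proj, Matrix.transpose_mul, Matrix.transpose_transpose, gram_inv_transpose,
    Matrix.mul_assoc]

lemma gram_inv_mul_gram_mul (X : Matrix (Fin d) (Fin r) ℝ) :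
    (Xᵀ * X)⁻¹ * (Xᵀ * X) * (Xᵀ * X)⁻¹ = (Xᵀ * X)⁻¹ := by
  by_cases h : IsUnit (Xᵀ * X).det
  · rw [Matrix.nonsing_inv_mul _ h, Matrix.one_mul]
  · rw [Matrix.nonsing_inv_apply_not_isUnit _ h, Matrix.mul_zero]

lemma proj_mul_self (X : Matrix (Fin d) (Fin r) ℝ) : proj X * proj X = proj X := by
  have h := gram_inv_mul_gram_mul X
  calc proj X * proj X = X * ((Xᵀ * X)⁻¹ * (Xᵀ * X) * (Xᵀ * X)⁻¹) * Xᵀ := by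
        simp only [proj, Matrix.mul_assoc]
    _ = proj X := by rw [h, proj]

lemma proj_mulVec_dotProduct (X : Matrix (Fin d) (Fin r) ℝ) (v w : Fin d → ℝ) :
    (proj X *ᵥ v) ⬝ᵥ w = v ⬝ᵥ (proj X *ᵥ w) := by
  conv_lhs => rw [← proj_transpose]
  exact dotProduct_mulVec_transpose _ _ _

lemma proj_mulVec_proj (X : Matrix (Fin d) (Fin r) ℝ) (v : Fin d → ℝ) :
    proj X *ᵥ (proj X *ᵥ v) = proj X *ᵥ v := by
  rw [Matrix.mulVec_mulVec, proj_mul_self]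

lemma nrm_sq_proj_add (X : Matrix (Fin d) (Fin r) ℝ) (v : Fin d → ℝ) :
    nrm v ^ 2 = nrm (proj X *ᵥ v) ^ 2 + nrm (v - proj X *ᵥ v) ^ 2 := by
  have h1 : (proj X *ᵥ v) ⬝ᵥ (proj X *ᵥ v) = v ⬝ᵥ (proj X *ᵥ v) := by
    rw [proj_mulVec_dotProduct, proj_mulVec_proj]
  simp only [nrm_sq, dotProduct_sub, sub_dotProduct]
  rw [dotProduct_comm (proj X *ᵥ v) v, h1]
  ring

lemma nrm_proj_le (X : Matrix (Fin d) (Fin r) ℝ) (v : Fin d → ℝ) : nrm (proj X *ᵥ v) ≤ nrm v := by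
  have := nrm_sq_proj_add X v
  exact abs_le_of_sq_le_sq' (by nlinarith [sq_nonneg (nrm (v - proj X *ᵥ v))]) (nrm_nonneg _) |>.2

lemma nrm_sub_proj_le (X : Matrix (Fin d) (Fin r) ℝ) (v : Fin d → ℝ) :
    nrm (v - proj X *ᵥ v) ≤ nrm v := by
  have := nrm_sq_proj_add X v
  exact abs_le_of_sq_le_sq' (by nlinarith [sq_nonneg (nrm (proj X *ᵥ v))]) (nrm_nonneg _) |>.2

lemma g_eq_nrm_sq (X : Matrix (Fin d) (Fin r) ℝ) (i : Fin d) :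
    g X i = nrm (proj X *ᵥ Pi.single i 1) ^ 2 := by
  rw [nrm_sq, proj_mulVec_dotProduct, proj_mulVec_proj]
  simp [g, proj]

lemma nrm_proj_single_le_one (X : Matrix (Fin d) (Fin r) ℝ) (i : Fin d) :
    nrm (proj X *ᵥ Pi.single i 1) ≤ 1 := by
  simpa [nrm_single] using nrm_proj_le X (Pi.single i 1)

lemma abs_proj_mulVec_apply_le (X : Matrix (Fin d) (Fin r) ℝ) (v : Fin d → ℝ) (i : Fin d) :
    |(proj X *ᵥ v) i| ≤ nrm (proj X *ᵥ Pi.single i 1) * nrm v := by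
  have h := abs_dotProduct_le (proj X *ᵥ Pi.single i 1) v
  rwa [proj_mulVec_dotProduct, single_one_dotProduct] at h

end Proj

/-! ### The error matrix and the pseudo-inverse near the ground truth -/

section Local

variable {d r : ℕ}

/-- The error matrix `X Xᵀ - Z Zᵀ`. -/
def err (Z X : Matrix (Fin d) (Fin r) ℝ) : Matrix (Fin d) (Fin d) ℝ := X * Xᵀ - Z * Zᵀ

lemma f_eq_frob (Z X : Matrix (Fin d) (Fin r) ℝ) : f Z X = frob (err Z X) := f_eq_sum Z X

lemma f_nonneg (Z X : Matrix (Fin d) (Fin r) ℝ) : 0 ≤ f Z X := by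
  rw [f_eq_frob]; exact frob_nonneg _

lemma err_transpose (Z X : Matrix (Fin d) (Fin r) ℝ) : (err Z X)ᵀ = err Z X := by
  simp [err, Matrix.transpose_sub, Matrix.transpose_mul]

lemma err_apply_comm (Z X : Matrix (Fin d) (Fin r) ℝ) (i j : Fin d) :
    err Z X i j = err Z X j i :=
  congrFun (congrFun (err_transpose Z X) j) i

lemma nrm_err_mulVec_le (Z X : Matrix (Fin d) (Fin r) ℝ) (v : Fin d → ℝ) :
    nrm (err Z X *ᵥ v) ≤ √(f Z X) * nrm v := by
  rw [f_eq_frob]; exact nrm_mulVec_le _ _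

lemma err_mulVec (Z X : Matrix (Fin d) (Fin r) ℝ) (v : Fin d → ℝ) :
    err Z X *ᵥ v = X *ᵥ (Xᵀ *ᵥ v) - Z *ᵥ (Zᵀ *ᵥ v) := by
  simp [err, Matrix.sub_mulVec, Matrix.mulVec_mulVec]

lemma mul_sq_le_sq_of_sq_le_mul {m a b c : ℝ} (hm : 0 ≤ m) (h : a ^ 2 ≤ b * c)
    (hc : m * c ^ 2 ≤ a ^ 2) : m * a ^ 2 ≤ b ^ 2 := by
  rcases (sq_nonneg a).eq_or_lt with ha | ha
  · rw [← ha, mul_zero]; positivity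
  · have h4 : a ^ 2 * a ^ 2 ≤ b ^ 2 * c ^ 2 := by
      have := pow_le_pow_left₀ ha.le h 2
      rw [mul_pow] at this
      linarith
    have h5 : m * (b ^ 2 * c ^ 2) ≤ b ^ 2 * a ^ 2 := by nlinarith [sq_nonneg b]
    have h6 : (m * a ^ 2) * a ^ 2 ≤ b ^ 2 * a ^ 2 := by nlinarith
    exact le_of_mul_le_mul_right h6 ha

lemma nrm_sq_mulVec_le (A : Matrix (Fin d) (Fin r) ℝ) (v : Fin r → ℝ) :
    nrm (A *ᵥ v) ^ 2 ≤ nrm (Aᵀ *ᵥ (A *ᵥ v)) * nrm v := by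
  rw [nrm_sq, ← dotProduct_mulVec_transpose]
  exact (le_abs_self _).trans (abs_dotProduct_le _ _)

/-- `X` is bounded below by `m`: `m ‖w‖² ≤ ‖X w‖²`, that is, `λ_min(Xᵀ X) ≥ m`. -/
def BddBelowBy (X : Matrix (Fin d) (Fin r) ℝ) (m : ℝ) : Prop :=
  ∀ w, m * nrm w ^ 2 ≤ nrm (X *ᵥ w) ^ 2

variable {Z X : Matrix (Fin d) (Fin r) ℝ} {lam ρ m : ℝ}

lemma BddBelowBy.isUnit_det (hm : 0 < m) (hX : BddBelowBy X m) : IsUnit (Xᵀ * X).det := by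
  rw [← Matrix.isUnit_iff_isUnit_det, ← Matrix.mulVec_injective_iff_isUnit]
  refine (injective_iff_map_eq_zero (Xᵀ * X).mulVecLin).2 fun w hw => ?_
  rw [Matrix.mulVecLin_apply, ← Matrix.mulVec_mulVec] at hw
  have h1 := nrm_sq_mulVec_le X w
  have h2 : nrm (Xᵀ *ᵥ (X *ᵥ w)) = 0 := nrm_eq_zero.2 hw
  have h3 := hX w
  rw [h2, zero_mul] at h1
  have h4 : nrm w ^ 2 ≤ 0 := by nlinarith
  exact nrm_eq_zero.1 (pow_eq_zero_iff two_ne_zero |>.1 (le_antisymm h4 (sq_nonneg _)))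

lemma nrm_transpose_sq_ge (hm : 0 ≤ m) (hX : BddBelowBy X m) (w : Fin r → ℝ) :
    m * nrm (X *ᵥ w) ^ 2 ≤ nrm (Xᵀ *ᵥ (X *ᵥ w)) ^ 2 :=
  mul_sq_le_sq_of_sq_le_mul hm (nrm_sq_mulVec_le X w) (hX w)

lemma sqrt_f_le (hlam : 0 ≤ lam) (hρ : 0 ≤ ρ) (hf : f Z X ≤ (ρ * lam) ^ 2) :
    √(f Z X) ≤ ρ * lam :=
  Real.sqrt_le_iff.2 ⟨by positivity, hf⟩

lemma abs_dotProduct_err_le (hlam : 0 ≤ lam) (hρ : 0 ≤ ρ) (hf : f Z X ≤ (ρ * lam) ^ 2)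
    (v : Fin d → ℝ) : |v ⬝ᵥ (err Z X *ᵥ v)| ≤ ρ * lam * nrm v ^ 2 := by
  refine (abs_dotProduct_le _ _).trans ?_
  have h1 := nrm_err_mulVec_le Z X v
  have h2 := sqrt_f_le hlam hρ hf
  have h3 := nrm_nonneg v
  nlinarith [mul_le_mul_of_nonneg_right h2 h3]

lemma dotProduct_err (v : Fin d → ℝ) :
    v ⬝ᵥ (err Z X *ᵥ v) = nrm (Xᵀ *ᵥ v) ^ 2 - nrm (Zᵀ *ᵥ v) ^ 2 := by
  rw [err_mulVec, dotProduct_sub, ← dotProduct_mulVec_transpose X, ← dotProduct_mulVec_transpose Z,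
    nrm_sq, nrm_sq]

/-- A Weyl-type bound: `λ_min(Xᵀ X) ≥ λ_min(Zᵀ Z) - ‖X Xᵀ - Z Zᵀ‖`. Since `Xᵀ Z` is injective it is
onto, so every `w` is of the form `Xᵀ v` with `v` in the column space of `Z`, where `X Xᵀ` is
bounded below. -/
lemma bddBelowBy_of_f_le (hlam : 0 < lam) (hρ : 0 ≤ ρ) (hρ1 : ρ < 1) (hZ : BddBelowBy Z lam)
    (hf : f Z X ≤ (ρ * lam) ^ 2) : BddBelowBy X ((1 - ρ) * lam) := by
  have hm : 0 < (1 - ρ) * lam := mul_pos (by linarith) hlam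
  have ha : ∀ u, (1 - ρ) * lam * nrm (Z *ᵥ u) ^ 2 ≤ nrm (Xᵀ *ᵥ (Z *ᵥ u)) ^ 2 := by
    intro u
    have h1 := nrm_transpose_sq_ge hlam.le hZ u
    have h2 := (abs_le.1 (abs_dotProduct_err_le hlam.le hρ hf (Z *ᵥ u))).1
    rw [dotProduct_err] at h2
    nlinarith
  have hinj : Function.Injective (Xᵀ * Z).mulVec := by
    refine (injective_iff_map_eq_zero (Xᵀ * Z).mulVecLin).2 fun u hu => ?_
    rw [Matrix.mulVecLin_apply, ← Matrix.mulVec_mulVec] at hu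
    have h1 := ha u
    rw [nrm_eq_zero.2 hu] at h1
    have h2 := hZ u
    have h3 : nrm (Z *ᵥ u) ^ 2 ≤ 0 := by nlinarith
    have h4 : nrm u ^ 2 ≤ 0 := by nlinarith
    exact nrm_eq_zero.1 (pow_eq_zero_iff two_ne_zero |>.1 (le_antisymm h4 (sq_nonneg _)))
  have hsurj := Matrix.mulVec_surjective_iff_isUnit.2 (Matrix.mulVec_injective_iff_isUnit.1 hinj)
  intro w
  obtain ⟨u, hu⟩ := hsurj w
  rw [← Matrix.mulVec_mulVec] at hu
  have h1 := ha u
  rw [hu] at h1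
  refine mul_sq_le_sq_of_sq_le_mul hm.le ?_ h1
  rw [nrm_sq]
  nth_rewrite 1 [← hu]
  rw [dotProduct_mulVec_transpose, mul_comm]
  exact (le_abs_self _).trans (abs_dotProduct_le _ _)

/-- The matrix `X (Xᵀ X)⁻² Xᵀ`, the pseudo-inverse of `X Xᵀ`. -/
noncomputable def pinv (X : Matrix (Fin d) (Fin r) ℝ) : Matrix (Fin d) (Fin d) ℝ :=
  X * ((Xᵀ * X)⁻¹ * (Xᵀ * X)⁻¹) * Xᵀ

lemma pinv_transpose (X : Matrix (Fin d) (Fin r) ℝ) : (pinv X)ᵀ = pinv X := by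
  simp only [pinv, Matrix.transpose_mul, Matrix.transpose_transpose, gram_inv_transpose,
    Matrix.mul_assoc]

lemma pinv_mulVec_dotProduct (X : Matrix (Fin d) (Fin r) ℝ) (v w : Fin d → ℝ) :
    (pinv X *ᵥ v) ⬝ᵥ w = v ⬝ᵥ (pinv X *ᵥ w) := by
  conv_lhs => rw [← pinv_transpose]
  exact dotProduct_mulVec_transpose _ _ _

lemma pinv_mul_proj (X : Matrix (Fin d) (Fin r) ℝ) : pinv X * proj X = pinv X := by
  have h := gram_inv_mul_gram_mul X
  calc pinv X * proj X
      = X * (Xᵀ * X)⁻¹ * ((Xᵀ * X)⁻¹ * (Xᵀ * X) * (Xᵀ * X)⁻¹) * Xᵀ := by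
        simp only [proj, pinv, Matrix.mul_assoc]
    _ = pinv X := by rw [h, pinv]; simp only [Matrix.mul_assoc]

lemma proj_mul_pinv (X : Matrix (Fin d) (Fin r) ℝ) : proj X * pinv X = pinv X := by
  have h := congrArg Matrix.transpose (pinv_mul_proj X)
  rwa [Matrix.transpose_mul, proj_transpose, pinv_transpose] at h

lemma pinv_mulVec_proj (X : Matrix (Fin d) (Fin r) ℝ) (v : Fin d → ℝ) :
    pinv X *ᵥ (proj X *ᵥ v) = pinv X *ᵥ v := by
  rw [Matrix.mulVec_mulVec, pinv_mul_proj]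

lemma proj_mulVec_pinv (X : Matrix (Fin d) (Fin r) ℝ) (v : Fin d → ℝ) :
    proj X *ᵥ (pinv X *ᵥ v) = pinv X *ᵥ v := by
  rw [Matrix.mulVec_mulVec, proj_mul_pinv]

lemma proj_mul (h : IsUnit (Xᵀ * X).det) : proj X * X = X := by
  rw [proj, Matrix.mul_assoc, Matrix.mul_assoc, Matrix.nonsing_inv_mul _ h, Matrix.mul_one]

lemma transpose_mul_proj (h : IsUnit (Xᵀ * X).det) : Xᵀ * proj X = Xᵀ := by
  have := congrArg Matrix.transpose (proj_mul h)
  rwa [Matrix.transpose_mul, proj_transpose] at this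

lemma pinv_mul (h : IsUnit (Xᵀ * X).det) : pinv X * X = X * (Xᵀ * X)⁻¹ := by
  rw [pinv, Matrix.mul_assoc, Matrix.mul_assoc, Matrix.mul_assoc, Matrix.nonsing_inv_mul _ h,
    Matrix.mul_one]

lemma mul_transpose_mul_pinv (h : IsUnit (Xᵀ * X).det) : X * (Xᵀ * pinv X) = proj X := by
  have : X * (Xᵀ * pinv X) = X * ((Xᵀ * X) * (Xᵀ * X)⁻¹) * (Xᵀ * X)⁻¹ * Xᵀ := by
    simp only [pinv, Matrix.mul_assoc]
  rw [this, Matrix.mul_nonsing_inv _ h, Matrix.mul_one, proj]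

lemma transpose_mulVec_sub_proj (h : IsUnit (Xᵀ * X).det) (v : Fin d → ℝ) :
    Xᵀ *ᵥ (v - proj X *ᵥ v) = 0 := by
  rw [Matrix.mulVec_sub, Matrix.mulVec_mulVec, transpose_mul_proj h, sub_self]

lemma nrm_pinv_le (hm : 0 < m) (hX : BddBelowBy X m) (v : Fin d → ℝ) :
    m * nrm (pinv X *ᵥ v) ≤ nrm (proj X *ᵥ v) := by
  have hu := hX.isUnit_det hm
  set w := (Xᵀ * X)⁻¹ *ᵥ (Xᵀ *ᵥ v) with hw
  set s := (Xᵀ * X)⁻¹ *ᵥ w with hs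
  have e1 : pinv X *ᵥ v = X *ᵥ s := by
    simp only [pinv, hs, hw, Matrix.mulVec_mulVec, Matrix.mul_assoc]
  have e2 : proj X *ᵥ v = X *ᵥ w := by
    simp only [proj, hw, Matrix.mulVec_mulVec, Matrix.mul_assoc]
  have e3 : Xᵀ *ᵥ (X *ᵥ s) = w := by
    rw [hs, Matrix.mulVec_mulVec, Matrix.mulVec_mulVec, Matrix.mul_nonsing_inv _ hu,
      Matrix.one_mulVec]
  have h1 := nrm_transpose_sq_ge hm.le hX s
  rw [e3] at h1
  have h2 := hX w
  rw [e1, e2]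
  refine abs_le_of_sq_le_sq' ?_ (nrm_nonneg _) |>.2
  nlinarith

/-- Entries of the pseudo-inverse are small when the coherence is. -/
lemma abs_pinv_mulVec_apply_le (hm : 0 < m) (hX : BddBelowBy X m) (v : Fin d → ℝ) (i : Fin d) :
    m * |(pinv X *ᵥ v) i| ≤ nrm (proj X *ᵥ Pi.single i 1) * nrm (proj X *ᵥ v) := by
  have h1 := abs_proj_mulVec_apply_le X (pinv X *ᵥ v) i
  rw [proj_mulVec_pinv] at h1
  have h2 := nrm_pinv_le hm hX v
  have h3 := nrm_nonneg (proj X *ᵥ Pi.single i 1)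
  nlinarith [mul_le_mul_of_nonneg_left h2 h3]

/-- The part `(1 - P) (X Xᵀ - Z Zᵀ)` of the error sees only the column space of `Z` on the right. -/
lemma err_sub_proj_mul_proj (hX : IsUnit (Xᵀ * X).det) (hZ : IsUnit (Zᵀ * Z).det) :
    (err Z X - proj X * err Z X) * proj Z = err Z X - proj X * err Z X := by
  have h1 : proj X * (X * Xᵀ) = X * Xᵀ := by rw [← Matrix.mul_assoc, proj_mul hX]
  have h2 : err Z X - proj X * err Z X = proj X * (Z * Zᵀ) - Z * Zᵀ := by
    rw [err, Matrix.mul_sub, h1]; abel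
  rw [h2, Matrix.sub_mul, Matrix.mul_assoc, Matrix.mul_assoc, transpose_mul_proj hZ]

/-- Entries of the error are small when the coherences of `X` and `Z` are. -/
lemma abs_err_apply_le (hX : IsUnit (Xᵀ * X).det) (hZ : IsUnit (Zᵀ * Z).det) (k l : Fin d) :
    |err Z X k l| ≤ (nrm (proj X *ᵥ Pi.single k 1) + nrm (proj Z *ᵥ Pi.single l 1)) *
      √(f Z X) := by
  set q := proj Z *ᵥ Pi.single l 1
  have e0 : err Z X *ᵥ Pi.single l 1 = proj X *ᵥ (err Z X *ᵥ Pi.single l 1) +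
      (err Z X *ᵥ q - proj X *ᵥ (err Z X *ᵥ q)) := by
    have h := congrArg (fun M => M *ᵥ (Pi.single l 1 : Fin d → ℝ)) (err_sub_proj_mul_proj hX hZ)
    simp only [Matrix.sub_mulVec, ← Matrix.mulVec_mulVec] at h
    rw [h]; abel
  have e1 : err Z X k l = (err Z X *ᵥ Pi.single l 1) k := by simp
  have h1 := abs_proj_mulVec_apply_le X (err Z X *ᵥ Pi.single l 1) k
  have h2 := abs_apply_le_nrm (err Z X *ᵥ q - proj X *ᵥ (err Z X *ᵥ q)) k
  have h3 := nrm_sub_proj_le X (err Z X *ᵥ q)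
  have h4 := nrm_err_mulVec_le Z X q
  have h5 := nrm_err_mulVec_le Z X (Pi.single l 1)
  rw [nrm_single, mul_one] at h5
  rw [e1, e0, Pi.add_apply]
  have h6 := mul_le_mul_of_nonneg_left h5 (nrm_nonneg (proj X *ᵥ Pi.single k 1))
  refine (abs_add_le _ _).trans ?_
  linarith

lemma frob_eq_proj_mul_add (X : Matrix (Fin d) (Fin r) ℝ) {n : ℕ} (A : Matrix (Fin d) (Fin n) ℝ) :
    frob A = frob (proj X * A) + frob (A - proj X * A) := by
  simp only [frob_eq_sum_cols, ← Finset.sum_add_distrib]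
  exact Finset.sum_congr rfl fun j _ => nrm_sq_proj_add X (A.col j)

/-- On the orthogonal complement of the column space of `X`, the matrix `Z` is small. -/
lemma nrm_sub_proj_mulVec_sq_le (hlam : 0 ≤ lam) (hρ : 0 ≤ ρ) (hX : IsUnit (Xᵀ * X).det)
    (hf : f Z X ≤ (ρ * lam) ^ 2) (a : Fin r → ℝ) :
    nrm (Z *ᵥ a - proj X *ᵥ (Z *ᵥ a)) ^ 2 ≤ ρ * lam * nrm a ^ 2 := by
  set y := Z *ᵥ a - proj X *ᵥ (Z *ᵥ a) with hy
  have h0 : Xᵀ *ᵥ y = 0 := transpose_mulVec_sub_proj hX _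
  have hPy : proj X *ᵥ y = 0 := by
    rw [hy, Matrix.mulVec_sub, proj_mulVec_proj, sub_self]
  have h1 : nrm y ^ 2 = (Zᵀ *ᵥ y) ⬝ᵥ a := by
    rw [dotProduct_mulVec_transpose, nrm_sq]
    nth_rewrite 2 [hy]
    rw [dotProduct_sub, ← proj_mulVec_dotProduct, hPy, zero_dotProduct, sub_zero]
  have h2 : nrm y ^ 2 ≤ nrm (Zᵀ *ᵥ y) * nrm a := by
    rw [h1]; exact (le_abs_self _).trans (abs_dotProduct_le _ _)
  have h3 : nrm (Zᵀ *ᵥ y) ^ 2 ≤ ρ * lam * nrm y ^ 2 := by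
    have h := (abs_le.1 (abs_dotProduct_err_le hlam hρ hf y)).1
    rw [dotProduct_err, h0, nrm_eq_zero.2 rfl] at h
    linarith
  rcases (sq_nonneg (nrm y)).eq_or_lt with hy0 | hy0
  · rw [← hy0]; positivity
  have h4 : nrm y ^ 2 * nrm y ^ 2 ≤ (nrm (Zᵀ *ᵥ y)) ^ 2 * nrm a ^ 2 := by
    have := pow_le_pow_left₀ hy0.le h2 2
    rw [mul_pow] at this
    linarith
  have h5 := mul_le_mul_of_nonneg_right h3 (sq_nonneg (nrm a))
  exact le_of_mul_le_mul_right (by linarith) hy0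

/-- The component of the error along the column space of `X` carries a fixed proportion of it. -/
lemma f_le_three_mul_frob (hlam : 0 < lam) (hρ : 0 ≤ ρ) (hρ1 : ρ ≤ 1 / 2) (hZ : BddBelowBy Z lam)
    (hX : IsUnit (Xᵀ * X).det) (hf : f Z X ≤ (ρ * lam) ^ 2) :
    f Z X ≤ 3 * frob (proj X * err Z X) := by
  set P := proj X with hP
  set E := err Z X with hE
  have hEt : Eᵀ = E := err_transpose Z X
  have hPt : Pᵀ = P := proj_transpose X
  -- split `E` on the left, then `(1 - P) E` on the right
  have h1 : f Z X = frob (P * E) + frob (E - P * E) := by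
    rw [f_eq_frob]; exact frob_eq_proj_mul_add X E
  set B := E - P * E with hB
  have hBt : Bᵀ = E - E * P := by
    rw [hB, Matrix.transpose_sub, Matrix.transpose_mul, hEt, hPt]
  have h2 : frob B = frob (P * Bᵀ) + frob (Bᵀ - P * Bᵀ) := by
    rw [← frob_transpose B]; exact frob_eq_proj_mul_add X Bᵀ
  have h3 : frob (P * Bᵀ) ≤ frob (P * E) := by
    have e : P * Bᵀ = ((P * E)ᵀ - P * (P * E)ᵀ)ᵀ := by
      simp only [hBt, Matrix.transpose_sub, Matrix.transpose_mul, hEt, hPt, Matrix.mul_sub,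
        Matrix.mul_assoc]
    rw [e, frob_transpose, ← frob_transpose (P * E), frob_eq_proj_mul_add X (P * E)ᵀ]
    linarith [frob_nonneg (proj X * (P * E)ᵀ)]
  have h4 : frob (Bᵀ - P * Bᵀ) ≤ frob (P * Bᵀ) := by
    -- `Bᵀ` has columns `-Z a` with `a` a row of `(1 - P) Z`
    have e : ∀ j, ∃ a, Bᵀ.col j = -(Z *ᵥ a) := by
      intro j
      refine ⟨(Z - P * Z) j, ?_⟩
      have : Bᵀ = -(Z * (Z - P * Z)ᵀ) := by
        have hXX : X * Xᵀ * P = X * Xᵀ := by rw [Matrix.mul_assoc, transpose_mul_proj hX]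
        rw [hBt, Matrix.transpose_sub, Matrix.transpose_mul, hPt, hE, err, Matrix.sub_mul, hXX,
          Matrix.mul_sub, Matrix.mul_assoc]
        abel
      rw [this]
      ext i
      simp [Matrix.mul_apply, Matrix.mulVec, dotProduct, mul_comm]
    rw [frob_eq_sum_cols, frob_eq_sum_cols]
    refine Finset.sum_le_sum fun j _ => ?_
    obtain ⟨a, ha⟩ := e j
    have c1 : (P * Bᵀ).col j = P *ᵥ Bᵀ.col j := rfl
    have c2 : (Bᵀ - P * Bᵀ).col j = Bᵀ.col j - P *ᵥ Bᵀ.col j := rfl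
    have k1 := nrm_sub_proj_mulVec_sq_le hlam.le hρ hX hf a
    have k2 := hZ a
    have k3 := nrm_sq_proj_add X (Z *ᵥ a)
    have k4 : ρ * lam * nrm a ^ 2 ≤ 1 / 2 * (lam * nrm a ^ 2) := by
      have : 0 ≤ lam * nrm a ^ 2 := by positivity
      nlinarith
    have n1 : nrm (P *ᵥ -(Z *ᵥ a)) = nrm (P *ᵥ (Z *ᵥ a)) := by
      simp [nrm, Matrix.mulVec_neg]
    have n2 : nrm (-(Z *ᵥ a) - P *ᵥ -(Z *ᵥ a)) = nrm (Z *ᵥ a - P *ᵥ (Z *ᵥ a)) := by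
      rw [Matrix.mulVec_neg, ← neg_sub', nrm, WithLp.toLp_neg, norm_neg, nrm]
    rw [c1, c2, ha, n1, n2]
    linarith
  linarith

/-- The drift of the coherence of row `i` pulls it towards that of the ground truth. -/
lemma neg_dotProduct_err_le (hlam : 0 < lam) (hρ : 0 ≤ ρ) (hρ1 : ρ < 1) (hZ : BddBelowBy Z lam)
    (hf : f Z X ≤ (ρ * lam) ^ 2) (i : Fin d) :
    -((pinv X *ᵥ Pi.single i 1) ⬝ᵥ
        (err Z X *ᵥ (Pi.single i 1 - proj X *ᵥ Pi.single i 1))) * (1 - ρ) ≤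
      nrm (proj X *ᵥ Pi.single i 1) * nrm (proj Z *ᵥ Pi.single i 1) -
        (1 - 2 * ρ) * nrm (proj X *ᵥ Pi.single i 1) ^ 2 := by
  have hm : 0 < (1 - ρ) * lam := mul_pos (by linarith) hlam
  have hXb := bddBelowBy_of_f_le hlam hρ hρ1 hZ hf
  have hX := hXb.isUnit_det hm
  have hZu := hZ.isUnit_det hlam
  set e : Fin d → ℝ := Pi.single i 1
  set a := pinv X *ᵥ e with ha
  set p := proj X *ᵥ e with hp
  set q := proj Z *ᵥ e with hq
  have e1 : Z *ᵥ (Zᵀ *ᵥ a) = p - err Z X *ᵥ a := by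
    have : X *ᵥ (Xᵀ *ᵥ a) = p := by
      rw [ha, Matrix.mulVec_mulVec, Matrix.mulVec_mulVec, Matrix.mul_assoc,
        mul_transpose_mul_pinv hX]
    rw [err_mulVec, this]; abel
  have e2 : (Z *ᵥ (Zᵀ *ᵥ a)) ⬝ᵥ e = (Z *ᵥ (Zᵀ *ᵥ a)) ⬝ᵥ q := by
    rw [hq, ← proj_mulVec_dotProduct, Matrix.mulVec_mulVec _ (proj Z), proj_mul hZu]
  have e3 : -(a ⬝ᵥ (err Z X *ᵥ (e - p))) = (p - err Z X *ᵥ a) ⬝ᵥ q - (p - err Z X *ᵥ a) ⬝ᵥ p := by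
    have : err Z X *ᵥ (e - p) = -(Z *ᵥ (Zᵀ *ᵥ (e - p))) := by
      rw [err_mulVec, transpose_mulVec_sub_proj hX]; simp
    rw [this, dotProduct_neg, neg_neg]
    have h : a ⬝ᵥ (Z *ᵥ (Zᵀ *ᵥ (e - p))) = (Z *ᵥ (Zᵀ *ᵥ a)) ⬝ᵥ (e - p) := by
      rw [← dotProduct_mulVec_transpose, dotProduct_comm, dotProduct_mulVec_transpose,
        dotProduct_comm]
    rw [h, dotProduct_sub, e2, e1]
  have hEa : (1 - ρ) * nrm (err Z X *ᵥ a) ≤ ρ * nrm p := by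
    have h1 := nrm_err_mulVec_le Z X a
    have h2 := sqrt_f_le hlam.le hρ hf
    have h3 := nrm_pinv_le hm hXb e
    have h4 : nrm (err Z X *ᵥ a) ≤ ρ * lam * nrm a :=
      h1.trans (mul_le_mul_of_nonneg_right h2 (nrm_nonneg _))
    calc (1 - ρ) * nrm (err Z X *ᵥ a) ≤ (1 - ρ) * (ρ * lam * nrm a) :=
          mul_le_mul_of_nonneg_left h4 (by linarith)
      _ = ρ * ((1 - ρ) * lam * nrm a) := by ring
      _ ≤ ρ * nrm p := mul_le_mul_of_nonneg_left h3 hρ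
  have b1 : (p - err Z X *ᵥ a) ⬝ᵥ q ≤ (nrm p + nrm (err Z X *ᵥ a)) * nrm q :=
    (le_abs_self _).trans ((abs_dotProduct_le _ _).trans
      (mul_le_mul_of_nonneg_right (nrm_sub_le _ _) (nrm_nonneg _)))
  have b2 : nrm p ^ 2 - nrm (err Z X *ᵥ a) * nrm p ≤ (p - err Z X *ᵥ a) ⬝ᵥ p := by
    rw [sub_dotProduct, nrm_sq]
    linarith [le_abs_self ((err Z X *ᵥ a) ⬝ᵥ p), abs_dotProduct_le (err Z X *ᵥ a) p]
  rw [e3]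
  have h1 := mul_le_mul_of_nonneg_right hEa (nrm_nonneg q)
  have h2 := mul_le_mul_of_nonneg_right hEa (nrm_nonneg p)
  have h3 : 0 ≤ 1 - ρ := by linarith
  have b3 := mul_le_mul_of_nonneg_right b1 h3
  have b4 := mul_le_mul_of_nonneg_right b2 h3
  nlinarith

end Local

/-! ### One step: the objective -/

section Step

variable {d r : ℕ}

/-- The hypotheses under which one step is analysed: `lam` is a lower bound for `λ_min(Zᵀ Z)`, the
matrix `X` has `f(X) ≤ (ρ lam)²` and coherence at most `s²`, and `Z` has coherence at most
`((1 - 2ρ) s / 4)²`. -/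
structure NearTruth (Z X : Matrix (Fin d) (Fin r) ℝ) (lam ρ s : ℝ) : Prop where
  lam_pos : 0 < lam
  rho_nonneg : 0 ≤ ρ
  rho_lt : ρ < 1 / 2
  below : BddBelowBy Z lam
  f_le : f Z X ≤ (ρ * lam) ^ 2
  s_pos : 0 < s
  coh_X : ∀ i, nrm (proj X *ᵥ Pi.single i 1) ≤ s
  coh_Z : ∀ i, nrm (proj Z *ᵥ Pi.single i 1) ≤ (1 - 2 * ρ) * s / 4

/-- The symmetric matrix `e_k e_lᵀ + e_l e_kᵀ`. -/
def symUnit (k l : Fin d) : Matrix (Fin d) (Fin d) ℝ :=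
  Matrix.vecMulVec (Pi.single k 1) (Pi.single l 1) +
    Matrix.vecMulVec (Pi.single l 1) (Pi.single k 1)

lemma symUnit_transpose (k l : Fin d) : (symUnit k l)ᵀ = symUnit k l := by
  simp [symUnit, Matrix.transpose_vecMulVec, add_comm]

lemma symUnit_mulVec (k l : Fin d) (v : Fin d → ℝ) :
    symUnit k l *ᵥ v = v l • Pi.single k 1 + v k • Pi.single l 1 := by
  simp [symUnit, Matrix.add_mulVec, Matrix.vecMulVec_mulVec]

lemma dotProduct_symUnit_mulVec (k l : Fin d) (v w : Fin d → ℝ) :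
    v ⬝ᵥ (symUnit k l *ᵥ w) = v k * w l + v l * w k := by
  simp [symUnit_mulVec, dotProduct_add, dotProduct_smul, mul_comm]

lemma nrm_symUnit_mulVec_le (k l : Fin d) (v : Fin d → ℝ) :
    nrm (symUnit k l *ᵥ v) ≤ |v k| + |v l| := by
  rw [symUnit_mulVec]
  refine (nrm_add_le _ _).trans ?_
  simp [nrm_smul, nrm_single, add_comm]

/-- One step of ScaledSGD with sampled index pair `p`. -/
noncomputable def update (Z : Matrix (Fin d) (Fin r) ℝ) (α : ℝ) (X : Matrix (Fin d) (Fin r) ℝ)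
    (p : Fin d × Fin d) : Matrix (Fin d) (Fin r) ℝ :=
  X - α • (stochGrad Z X p * (Xᵀ * X)⁻¹)

/-- The scalar factor `2 α d² (X Xᵀ - Z Zᵀ)_{kl}` of a step. -/
noncomputable def stepSize (Z : Matrix (Fin d) (Fin r) ℝ) (α : ℝ) (X : Matrix (Fin d) (Fin r) ℝ)
    (p : Fin d × Fin d) : ℝ :=
  2 * α * (d : ℝ) ^ 2 * err Z X p.1 p.2

lemma update_eq_mul_gram_inv (Z X : Matrix (Fin d) (Fin r) ℝ) (α : ℝ) (p : Fin d × Fin d) :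
    update Z α X p = X - stepSize Z α X p • (symUnit p.1 p.2 * (X * (Xᵀ * X)⁻¹)) := by
  have h : stochGrad Z X p = (2 * (d : ℝ) ^ 2 * err Z X p.1 p.2) • (symUnit p.1 p.2 * X) := by
    simp [stochGrad, symUnit, err, Matrix.add_mul, Matrix.vecMulVec_mul, Matrix.mul_apply',
      Matrix.row]
  rw [update, h, Matrix.smul_mul, smul_smul, stepSize, Matrix.mul_assoc]
  congr 2
  ring

variable {Z X : Matrix (Fin d) (Fin r) ℝ} {lam ρ s α : ℝ}

lemma update_eq (h : IsUnit (Xᵀ * X).det) (α : ℝ) (p : Fin d × Fin d) :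
    update Z α X p = X - stepSize Z α X p • (symUnit p.1 p.2 * (pinv X * X)) := by
  rw [update_eq_mul_gram_inv, pinv_mul h]

lemma err_update (Z X : Matrix (Fin d) (Fin r) ℝ) (α : ℝ) (p : Fin d × Fin d) :
    err Z (update Z α X p) = err Z X +
      ((-stepSize Z α X p) • (symUnit p.1 p.2 * proj X + proj X * symUnit p.1 p.2) +
        stepSize Z α X p ^ 2 • (symUnit p.1 p.2 * pinv X * symUnit p.1 p.2)) := by
  set η := stepSize Z α X p
  set J := symUnit p.1 p.2
  have hJ : Jᵀ = J := symUnit_transpose _ _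
  have h1 : X * (X * (Xᵀ * X)⁻¹)ᵀ = proj X := by
    rw [Matrix.transpose_mul, gram_inv_transpose, proj, Matrix.mul_assoc]
  have h2 : (X * (Xᵀ * X)⁻¹) * Xᵀ = proj X := rfl
  have h3 : (X * (Xᵀ * X)⁻¹) * (X * (Xᵀ * X)⁻¹)ᵀ = pinv X := by
    rw [Matrix.transpose_mul, gram_inv_transpose, pinv]; simp only [Matrix.mul_assoc]
  rw [err, err, update_eq_mul_gram_inv, Matrix.transpose_sub, Matrix.transpose_smul,
    Matrix.transpose_mul, hJ]
  simp only [Matrix.sub_mul, Matrix.mul_sub, Matrix.smul_mul, Matrix.mul_smul,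
    ← h3, ← h1]
  have h4 : X * ((X * (Xᵀ * X)⁻¹)ᵀ * J) = X * (X * (Xᵀ * X)⁻¹)ᵀ * J := (Matrix.mul_assoc _ _ _).symm
  have h5 : J * (X * (Xᵀ * X)⁻¹) * Xᵀ = J * (X * (X * (Xᵀ * X)⁻¹)ᵀ) := by
    rw [h1, Matrix.mul_assoc, h2]
  have h6 : J * (X * (Xᵀ * X)⁻¹) * ((X * (Xᵀ * X)⁻¹)ᵀ * J) =
      J * ((X * (Xᵀ * X)⁻¹) * (X * (Xᵀ * X)⁻¹)ᵀ) * J := by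
    simp only [Matrix.mul_assoc]
  rw [h4, h5, h6, sq]
  module

lemma symUnit_mul_proj_add (X : Matrix (Fin d) (Fin r) ℝ) (k l : Fin d) :
    symUnit k l * proj X + proj X * symUnit k l =
      Matrix.vecMulVec (Pi.single k 1) (proj X *ᵥ Pi.single l 1) +
      Matrix.vecMulVec (Pi.single l 1) (proj X *ᵥ Pi.single k 1) +
      (Matrix.vecMulVec (proj X *ᵥ Pi.single k 1) (Pi.single l 1) +
      Matrix.vecMulVec (proj X *ᵥ Pi.single l 1) (Pi.single k 1)) := by
  have h : ∀ v : Fin d → ℝ, v ᵥ* proj X = proj X *ᵥ v := fun v => by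
    rw [← Matrix.mulVec_transpose, proj_transpose]
  simp only [symUnit, Matrix.add_mul, Matrix.mul_add, Matrix.vecMulVec_mul, Matrix.mul_vecMulVec, h]

lemma symUnit_mul_pinv_mul (X : Matrix (Fin d) (Fin r) ℝ) (k l : Fin d) :
    symUnit k l * pinv X * symUnit k l =
      Matrix.vecMulVec (Pi.single k 1) (symUnit k l *ᵥ (pinv X *ᵥ Pi.single l 1)) +
      Matrix.vecMulVec (Pi.single l 1) (symUnit k l *ᵥ (pinv X *ᵥ Pi.single k 1)) := by
  have h : ∀ v : Fin d → ℝ, (v ᵥ* pinv X) ᵥ* symUnit k l = symUnit k l *ᵥ (pinv X *ᵥ v) :=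
    fun v => by
    rw [← Matrix.mulVec_transpose, ← Matrix.mulVec_transpose, symUnit_transpose, pinv_transpose]
  conv_lhs => rw [symUnit, Matrix.add_mul, Matrix.vecMulVec_mul, Matrix.vecMulVec_mul, ← symUnit,
    Matrix.add_mul, Matrix.vecMulVec_mul, Matrix.vecMulVec_mul, h, h]

lemma sum_err_sq (Z X : Matrix (Fin d) (Fin r) ℝ) :
    ∑ p : Fin d × Fin d, err Z X p.1 p.2 ^ 2 = f Z X := by
  rw [Fintype.sum_prod_type, f_eq_frob]; rfl

lemma sum_err_mul_proj_mul_err (Z X : Matrix (Fin d) (Fin r) ℝ) :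
    ∑ p : Fin d × Fin d, err Z X p.1 p.2 *
      ((proj X * err Z X) p.1 p.2 + (proj X * err Z X) p.2 p.1) =
      2 * frob (proj X * err Z X) := by
  set Y := proj X * err Z X with hY
  have h1 : frobInner (err Z X) Y = frob Y := by
    have e : ∀ l, ∑ k, err Z X k l * Y k l = nrm (Y.col l) ^ 2 := by
      intro l
      have c : Y.col l = proj X *ᵥ (err Z X).col l := rfl
      rw [c, nrm_sq, proj_mulVec_dotProduct, proj_mulVec_proj]
      rfl
    rw [frobInner, Finset.sum_comm, frob_eq_sum_cols]
    exact Finset.sum_congr rfl fun l _ => e l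
  have h2 : ∑ i, ∑ j, err Z X i j * Y j i = frobInner (err Z X) Y := by
    rw [frobInner, Finset.sum_comm]
    exact Finset.sum_congr rfl fun i _ => Finset.sum_congr rfl fun j _ => by
      rw [err_apply_comm]
  simp only [mul_add, Finset.sum_add_distrib, Fintype.sum_prod_type, h2]
  rw [← frobInner, h1]; ring

lemma one_add_pow_le (n : ℕ) {x : ℝ} (hx : n * |x| ≤ 1) (hx1 : -1 ≤ x) :
    (1 + x) ^ n ≤ 1 + n * x + (n * x) ^ 2 := by
  have h1 : (1 + x) ^ n ≤ Real.exp (n * x) := by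
    rw [Real.exp_nat_mul]
    exact pow_le_pow_left₀ (by linarith) (by linarith [Real.add_one_le_exp x]) n
  have h2 : |(n : ℝ) * x| ≤ 1 := by rwa [abs_mul, Nat.abs_cast]
  have h3 := Real.abs_exp_sub_one_sub_id_le h2
  linarith [(abs_le.1 h3).2]

namespace NearTruth

lemma m_pos (H : NearTruth Z X lam ρ s) : 0 < (1 - ρ) * lam :=
  mul_pos (by linarith [H.rho_lt]) H.lam_pos

lemma bddBelowBy (H : NearTruth Z X lam ρ s) : BddBelowBy X ((1 - ρ) * lam) :=
  bddBelowBy_of_f_le H.lam_pos H.rho_nonneg (by linarith [H.rho_lt]) H.below H.f_le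

lemma isUnit_det (H : NearTruth Z X lam ρ s) : IsUnit (Xᵀ * X).det :=
  H.bddBelowBy.isUnit_det H.m_pos

lemma sqrt_f_le (H : NearTruth Z X lam ρ s) : √(f Z X) ≤ ρ * lam :=
  ScaledSGD.sqrt_f_le H.lam_pos.le H.rho_nonneg H.f_le

lemma sqrt_f_le_m (H : NearTruth Z X lam ρ s) : √(f Z X) ≤ (1 - ρ) * lam :=
  H.sqrt_f_le.trans (mul_le_mul_of_nonneg_right (by linarith [H.rho_lt]) H.lam_pos.le)

lemma abs_err_le (H : NearTruth Z X lam ρ s) (k l : Fin d) :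
    |err Z X k l| ≤ 2 * s * √(f Z X) := by
  refine (abs_err_apply_le H.isUnit_det (H.below.isUnit_det H.lam_pos) k l).trans ?_
  refine mul_le_mul_of_nonneg_right ?_ (Real.sqrt_nonneg _)
  have := H.coh_X k
  have := H.coh_Z l
  nlinarith [H.s_pos, H.rho_nonneg, H.rho_lt, mul_nonneg H.rho_nonneg H.s_pos.le]

lemma abs_proj_mul_err_le (H : NearTruth Z X lam ρ s) (k l : Fin d) :
    |(proj X * err Z X) k l| ≤ s * √(f Z X) := by
  have e : (proj X * err Z X) k l = (proj X *ᵥ (err Z X *ᵥ Pi.single l 1)) k := by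
    rw [Matrix.mulVec_mulVec]; simp
  have h1 := abs_proj_mulVec_apply_le X (err Z X *ᵥ Pi.single l 1) k
  have h2 := nrm_err_mulVec_le Z X (Pi.single l 1)
  rw [nrm_single, mul_one] at h2
  rw [e]
  exact h1.trans (mul_le_mul (H.coh_X k) h2 (nrm_nonneg _) H.s_pos.le)

lemma abs_pinv_le (H : NearTruth Z X lam ρ s) (k l : Fin d) :
    (1 - ρ) * lam * |(pinv X *ᵥ Pi.single l 1) k| ≤ s ^ 2 := by
  rw [sq]
  exact (abs_pinv_mulVec_apply_le H.m_pos H.bddBelowBy (Pi.single l 1) k).trans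
    (mul_le_mul (H.coh_X k) (H.coh_X l) (nrm_nonneg _) H.s_pos.le)

lemma frob_first_le (H : NearTruth Z X lam ρ s) (k l : Fin d) :
    frob (symUnit k l * proj X + proj X * symUnit k l) ≤ 16 * s ^ 2 := by
  rw [symUnit_mul_proj_add]
  refine (frob_add_le _ _).trans ?_
  have hk := pow_le_pow_left₀ (nrm_nonneg _) (H.coh_X k) 2
  have hl := pow_le_pow_left₀ (nrm_nonneg _) (H.coh_X l) 2
  have h1 := frob_add_le (Matrix.vecMulVec (Pi.single k 1) (proj X *ᵥ Pi.single l 1))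
    (Matrix.vecMulVec (Pi.single l 1) (proj X *ᵥ Pi.single k 1))
  have h2 := frob_add_le (Matrix.vecMulVec (proj X *ᵥ Pi.single k 1) (Pi.single l 1))
    (Matrix.vecMulVec (proj X *ᵥ Pi.single l 1) (Pi.single k 1))
  simp only [frob_vecMulVec, nrm_single, one_pow, one_mul, mul_one] at h1 h2
  linarith

lemma frob_second_le (H : NearTruth Z X lam ρ s) (k l : Fin d) :
    ((1 - ρ) * lam) ^ 2 * frob (symUnit k l * pinv X * symUnit k l) ≤ 16 * (s ^ 2) ^ 2 := by
  have key : ∀ j, ((1 - ρ) * lam) ^ 2 *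
      nrm (symUnit k l *ᵥ (pinv X *ᵥ Pi.single j 1)) ^ 2 ≤ 4 * (s ^ 2) ^ 2 := by
    intro j
    have h1 := nrm_symUnit_mulVec_le k l (pinv X *ᵥ Pi.single j 1)
    have h2 := mul_le_mul_of_nonneg_left h1 H.m_pos.le
    have h3 : (1 - ρ) * lam * nrm (symUnit k l *ᵥ (pinv X *ᵥ Pi.single j 1)) ≤ 2 * s ^ 2 := by
      linarith [H.abs_pinv_le k j, H.abs_pinv_le l j]
    have h4 := pow_le_pow_left₀ (mul_nonneg H.m_pos.le (nrm_nonneg _)) h3 2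
    linarith
  rw [symUnit_mul_pinv_mul]
  have h1 := frob_add_le
    (Matrix.vecMulVec (Pi.single k 1) (symUnit k l *ᵥ (pinv X *ᵥ Pi.single l 1)))
    (Matrix.vecMulVec (Pi.single l 1) (symUnit k l *ᵥ (pinv X *ᵥ Pi.single k 1)))
  simp only [frob_vecMulVec, nrm_single, one_pow, one_mul] at h1
  have h2 := mul_le_mul_of_nonneg_left h1 (sq_nonneg ((1 - ρ) * lam))
  linarith [key k, key l]

lemma abs_stepSize_le (H : NearTruth Z X lam ρ s) (hα : 0 < α) (p : Fin d × Fin d) :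
    |stepSize Z α X p| ≤ 4 * α * (d : ℝ) ^ 2 * s * √(f Z X) := by
  rw [stepSize, abs_mul, abs_of_nonneg (by positivity)]
  have := mul_le_mul_of_nonneg_left (H.abs_err_le p.1 p.2)
    (by positivity : 0 ≤ 2 * α * (d : ℝ) ^ 2)
  linarith

/-- The objective after one step, up to a second-order error. -/
lemma abs_f_update_sub_le (H : NearTruth Z X lam ρ s) (hα : 0 < α)
    (hβ : 4 * (α * (d : ℝ) ^ 2 * s ^ 2) ≤ 1) (p : Fin d × Fin d) :
    |f Z (update Z α X p) - f Z X + 4 * stepSize Z α X p *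
      ((proj X * err Z X) p.1 p.2 + (proj X * err Z X) p.2 p.1)| ≤
      72 * (stepSize Z α X p ^ 2 * s ^ 2) := by
  obtain ⟨k, l⟩ := p
  set η := stepSize Z α X (k, l) with hη
  set S := symUnit k l * proj X + proj X * symUnit k l with hS
  set W := symUnit k l * pinv X * symUnit k l with hW
  set m := (1 - ρ) * lam with hm
  have hm0 : 0 < m := H.m_pos
  have hs := H.s_pos
  have e0 : f Z (update Z α X (k, l)) = f Z X + 2 * (-η * frobInner (err Z X) S +
      η ^ 2 * frobInner (err Z X) W) + frob ((-η) • S + η ^ 2 • W) := by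
    rw [f_eq_frob, err_update, frob_add, frobInner_add_right, frobInner_smul_right,
      frobInner_smul_right, f_eq_frob]
  have hEt : ∀ i j, (err Z X *ᵥ (proj X *ᵥ Pi.single j 1)) i = (proj X * err Z X) j i := by
    intro i j
    have : err Z X * proj X = (proj X * err Z X)ᵀ := by
      rw [Matrix.transpose_mul, err_transpose, proj_transpose]
    rw [Matrix.mulVec_mulVec, this, Matrix.mulVec_single_one]; rfl
  have hPE : ∀ i j, (proj X *ᵥ Pi.single i 1) ⬝ᵥ (err Z X *ᵥ Pi.single j 1) =
      (proj X * err Z X) i j := by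
    intro i j
    rw [proj_mulVec_dotProduct, Matrix.mulVec_mulVec]; simp
  have e1 : frobInner (err Z X) S =
      2 * ((proj X * err Z X) k l + (proj X * err Z X) l k) := by
    rw [hS, symUnit_mul_proj_add]
    simp only [frobInner_add_right, frobInner_vecMulVec, single_one_dotProduct, hEt, hPE]
    ring
  have hfs := H.frob_first_le k l
  have hfw := H.frob_second_le k l
  -- the cross term of second order
  have hEW : |frobInner (err Z X) W| ≤ 4 * s ^ 2 := by
    have h1 := frobInner_sq_le (err Z X) W
    rw [← f_eq_frob] at h1
    have h2 : f Z X ≤ m ^ 2 := by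
      have := pow_le_pow_left₀ (Real.sqrt_nonneg _) H.sqrt_f_le_m 2
      rwa [Real.sq_sqrt (f_nonneg _ _)] at this
    have h3 : frobInner (err Z X) W ^ 2 ≤ (4 * s ^ 2) ^ 2 := by
      have := mul_le_mul_of_nonneg_right h2 (frob_nonneg W)
      linarith
    exact abs_le_of_sq_le_sq h3 (by positivity)
  have hηs : |η| * s ≤ m := by
    have h1 := mul_le_mul_of_nonneg_right (H.abs_stepSize_le hα (k, l)) hs.le
    have h2 := mul_le_mul_of_nonneg_right hβ (Real.sqrt_nonneg (f Z X))
    have h3 := H.sqrt_f_le_m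
    linarith
  have hηW : η ^ 2 * frob W ≤ 16 * s ^ 2 := by
    have h1 : η ^ 2 * s ^ 2 ≤ m ^ 2 := by
      have := pow_le_pow_left₀ (by positivity) hηs 2
      rwa [mul_pow, sq_abs] at this
    have h2 : m ^ 2 * (η ^ 2 * frob W) ≤ m ^ 2 * (16 * s ^ 2) := by
      have h3 := mul_le_mul_of_nonneg_left hfw (sq_nonneg η)
      have h4 := mul_le_mul_of_nonneg_right h1 (by positivity : 0 ≤ 16 * s ^ 2)
      linarith
    exact le_of_mul_le_mul_left h2 (by positivity)
  have hΔ : frob ((-η) • S + η ^ 2 • W) ≤ 64 * (η ^ 2 * s ^ 2) := by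
    refine (frob_add_le _ _).trans ?_
    rw [frob_smul, frob_smul]
    have h1 := mul_le_mul_of_nonneg_left hfs (sq_nonneg η)
    have h2 := mul_le_mul_of_nonneg_left hηW (sq_nonneg η)
    linarith
  have hΔ0 := frob_nonneg ((-η) • S + η ^ 2 • W)
  have hEW2 : |η ^ 2 * frobInner (err Z X) W| ≤ 4 * (η ^ 2 * s ^ 2) := by
    rw [abs_mul, abs_of_nonneg (sq_nonneg η)]
    linarith [mul_le_mul_of_nonneg_left hEW (sq_nonneg η)]
  rw [e0, e1, abs_le]
  constructor <;> linarith [abs_le.1 hEW2]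

/-- Powers of the objective contract on average. -/
lemma sum_f_update_pow_le (H : NearTruth Z X lam ρ s) (hα : 0 < α) {n : ℕ} (hn : 1 ≤ n)
    (hβ : 4096 * (n * (α * (d : ℝ) ^ 2 * s ^ 2)) ≤ 1) (hα2 : α ≤ 1) :
    ∑ p : Fin d × Fin d, f Z (update Z α X p) ^ n ≤
      (d : ℝ) ^ 2 * ((1 - α / 2) ^ n * f Z X ^ n) := by
  set β := α * (d : ℝ) ^ 2 * s ^ 2 with hβd
  have hs := H.s_pos
  have hβ0 : 0 ≤ β := by positivity
  have hn1 : (1 : ℝ) ≤ n := by exact_mod_cast hn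
  have hβ1 : 4096 * β ≤ 1 := by nlinarith
  rcases (f_nonneg Z X).eq_or_lt with hf | hf
  · have hE : ∀ p : Fin d × Fin d, err Z X p.1 p.2 = 0 := by
      have h := sum_err_sq Z X
      rw [← hf, Finset.sum_eq_zero_iff_of_nonneg fun _ _ => sq_nonneg _] at h
      exact fun p => pow_eq_zero_iff two_ne_zero |>.1 (h p (Finset.mem_univ p))
    have hu : ∀ p, f Z (update Z α X p) = 0 := by
      intro p
      have : update Z α X p = X := by
        rw [update_eq_mul_gram_inv, stepSize, hE]; simp
      rw [this, ← hf]
    simp [hu, ← hf, show n ≠ 0 by omega]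
  set F := f Z X with hF
  set Y := proj X * err Z X with hY
  set x : Fin d × Fin d → ℝ := fun p => (f Z (update Z α X p) - F) / F with hx
  set η : Fin d × Fin d → ℝ := fun p => stepSize Z α X p with hη
  have hfx : ∀ p, f Z (update Z α X p) = F * (1 + x p) := by
    intro p; simp only [hx]; field_simp; ring
  have hη2 : ∀ p, η p ^ 2 * s ^ 2 ≤ 16 * β ^ 2 * F := by
    intro p
    have h1 := pow_le_pow_left₀ (abs_nonneg _) (H.abs_stepSize_le hα p) 2
    rw [sq_abs, mul_pow, Real.sq_sqrt hf.le] at h1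
    have h2 := mul_le_mul_of_nonneg_right h1 (sq_nonneg s)
    calc η p ^ 2 * s ^ 2 ≤ _ := h2
      _ = 16 * β ^ 2 * F := by rw [hβd]; ring
  have hYs : ∀ p : Fin d × Fin d, |Y p.1 p.2 + Y p.2 p.1| ≤ 2 * s * √F := fun p => by
    linarith [abs_add_le (Y p.1 p.2) (Y p.2 p.1), H.abs_proj_mul_err_le p.1 p.2,
      H.abs_proj_mul_err_le p.2 p.1]
  have hfirst : ∀ p, (4 * η p * (Y p.1 p.2 + Y p.2 p.1)) ^ 2 ≤ 64 * (η p ^ 2 * s ^ 2) * F := by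
    intro p
    have h1 := pow_le_pow_left₀ (abs_nonneg _) (hYs p) 2
    rw [sq_abs, mul_pow, Real.sq_sqrt hf.le] at h1
    have h2 := mul_le_mul_of_nonneg_left h1 (sq_nonneg (4 * η p))
    linarith
  have hrest := fun p => H.abs_f_update_sub_le hα (by linarith) p
  have hsq : ∀ p, (F * x p) ^ 2 ≤ 256 * (η p ^ 2 * s ^ 2) * F := by
    intro p
    have h0 : F * x p = f Z (update Z α X p) - F := by rw [hfx]; ring
    have h1 := hrest p
    set A := 4 * stepSize Z α X p * (Y p.1 p.2 + Y p.2 p.1) with hA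
    have h2 := pow_le_pow_left₀ (abs_nonneg _) h1 2
    rw [sq_abs] at h2
    have h3 : A ^ 2 ≤ 64 * (η p ^ 2 * s ^ 2) * F := hfirst p
    have h4 : (72 * (stepSize Z α X p ^ 2 * s ^ 2)) ^ 2 ≤ 64 * (η p ^ 2 * s ^ 2) * F := by
      have h5 := mul_le_mul_of_nonneg_left (hη2 p) (by positivity : 0 ≤ η p ^ 2 * s ^ 2)
      have h6 : β ^ 2 ≤ (1 / 4096) ^ 2 := pow_le_pow_left₀ hβ0 (by linarith) 2
      have h7 : 0 ≤ η p ^ 2 * s ^ 2 * F := by positivity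
      have h8 := mul_le_mul_of_nonneg_right h6 h7
      change (72 * (η p ^ 2 * s ^ 2)) ^ 2 ≤ _
      linarith
    rw [h0]
    linarith [sq_nonneg (f Z (update Z α X p) - F + A + A)]
  have hxle : ∀ p, |x p| ≤ 64 * β := by
    intro p
    refine abs_le_of_sq_le_sq ?_ (by positivity)
    have h1 := hsq p
    have h2 := mul_le_mul_of_nonneg_right (hη2 p) hf.le
    have h3 : F ^ 2 * x p ^ 2 ≤ F ^ 2 * (64 * β) ^ 2 := by
      rw [← mul_pow]; nlinarith
    exact le_of_mul_le_mul_left h3 (by positivity)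
  have hterm : ∀ p, f Z (update Z α X p) ^ n ≤ F ^ n * (1 + n * x p + n ^ 2 * x p ^ 2) := by
    intro p
    rw [hfx, mul_pow]
    refine mul_le_mul_of_nonneg_left ?_ (by positivity)
    have h1 := hxle p
    have := one_add_pow_le n (x := x p)
      (by nlinarith [mul_le_mul_of_nonneg_left h1 (by linarith : (0 : ℝ) ≤ n)])
      (by linarith [(abs_le.1 h1).1])
    linarith
  have hsumη : ∑ p, η p ^ 2 * s ^ 2 = 4 * α * β * (d : ℝ) ^ 2 * F := by
    have : ∀ p, η p ^ 2 * s ^ 2 = 4 * α * β * (d : ℝ) ^ 2 * err Z X p.1 p.2 ^ 2 := fun p => by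
      simp only [hη, stepSize, hβd]; ring
    simp only [this, ← Finset.mul_sum, sum_err_sq]
    rw [hF]
  have hsum1 : ∑ p, F * x p ≤ (d : ℝ) ^ 2 * (-(16 / 3) * α * F + 288 * α * β * F) := by
    have h0 : ∀ p, F * x p ≤ -(8 * α * (d : ℝ) ^ 2) *
        (err Z X p.1 p.2 * (Y p.1 p.2 + Y p.2 p.1)) + 72 * (η p ^ 2 * s ^ 2) := by
      intro p
      have h1 := (abs_le.1 (hrest p)).2
      have h2 : F * x p = f Z (update Z α X p) - F := by rw [hfx]; ring
      have h3 : 4 * stepSize Z α X p * (Y p.1 p.2 + Y p.2 p.1) = (8 * α * (d : ℝ) ^ 2) *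
        (err Z X p.1 p.2 * (Y p.1 p.2 + Y p.2 p.1)) := by rw [stepSize]; ring
      rw [h2]
      linarith
    refine (Finset.sum_le_sum fun p _ => h0 p).trans ?_
    rw [Finset.sum_add_distrib, ← Finset.mul_sum, ← Finset.mul_sum, hsumη,
      sum_err_mul_proj_mul_err]
    have h3 := f_le_three_mul_frob H.lam_pos H.rho_nonneg H.rho_lt.le H.below H.isUnit_det H.f_le
    have h4 := mul_le_mul_of_nonneg_left h3 (by positivity : 0 ≤ α * (d : ℝ) ^ 2)
    linarith
  have hsum2 : ∑ p, (F * x p) ^ 2 ≤ (d : ℝ) ^ 2 * (1024 * α * β * F ^ 2) := by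
    refine (Finset.sum_le_sum fun p _ => hsq p).trans ?_
    rw [← Finset.sum_mul, ← Finset.mul_sum, hsumη]
    exact le_of_eq (by ring)
  have hs1 : ∑ p, x p ≤ (d : ℝ) ^ 2 * (-(16 / 3) * α + 288 * α * β) := by
    rw [← Finset.mul_sum] at hsum1
    exact le_of_mul_le_mul_left (hsum1.trans_eq (by ring)) hf
  have hs2 : ∑ p, x p ^ 2 ≤ (d : ℝ) ^ 2 * (1024 * α * β) := by
    simp only [mul_pow, ← Finset.mul_sum] at hsum2
    exact le_of_mul_le_mul_left (hsum2.trans_eq (by ring)) (by positivity : 0 < F ^ 2)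
  have hB : 1 - n * (α / 2) ≤ (1 - α / 2) ^ n := by
    have := one_add_mul_le_pow (a := -(α / 2)) (by linarith) n
    rw [← sub_eq_add_neg] at this
    linarith
  calc ∑ p, f Z (update Z α X p) ^ n
      ≤ ∑ p, F ^ n * (1 + n * x p + n ^ 2 * x p ^ 2) := Finset.sum_le_sum fun p _ => hterm p
    _ = F ^ n * ((d : ℝ) ^ 2 + n * ∑ p, x p + n ^ 2 * ∑ p, x p ^ 2) := by
        rw [← Finset.mul_sum, Finset.sum_add_distrib, Finset.sum_add_distrib, ← Finset.mul_sum,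
          ← Finset.mul_sum]
        simp [sq]
    _ ≤ F ^ n * ((d : ℝ) ^ 2 * (1 - α / 2) ^ n) := by
        refine mul_le_mul_of_nonneg_left ?_ (by positivity)
        have k1 := mul_le_mul_of_nonneg_left hs1 (by linarith : (0 : ℝ) ≤ n)
        have k2 := mul_le_mul_of_nonneg_left hs2 (sq_nonneg (n : ℝ))
        have k3 := mul_le_mul_of_nonneg_left hB (sq_nonneg (d : ℝ))
        have k4 : 0 ≤ (d : ℝ) ^ 2 * (n * α) := by positivity
        have k5 := mul_le_mul_of_nonneg_left hβ k4
        have k6 := mul_le_mul_of_nonneg_left hβ1 k4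
        linarith
    _ = (d : ℝ) ^ 2 * ((1 - α / 2) ^ n * F ^ n) := by ring

end NearTruth
end Step

/-! ### One step: the coherence -/

section Coherence

variable {d r : ℕ} {Z X : Matrix (Fin d) (Fin r) ℝ} {lam ρ s α : ℝ}

/-- If `n` is orthogonal to the columns of `Y`, then `e_i` and `e_i - n` have the same projection
onto the column space of `Y`. -/
lemma g_le_nrm_sub_sq (Y : Matrix (Fin d) (Fin r) ℝ) (i : Fin d) {n : Fin d → ℝ}
    (hn : Yᵀ *ᵥ n = 0) : g Y i ≤ nrm (Pi.single i 1 - n) ^ 2 := by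
  have h0 : proj Y *ᵥ n = 0 := by
    rw [proj, ← Matrix.mulVec_mulVec, hn, Matrix.mulVec_zero]
  have h1 : proj Y *ᵥ Pi.single i 1 = proj Y *ᵥ (Pi.single i 1 - n) := by
    rw [Matrix.mulVec_sub, h0, sub_zero]
  rw [g_eq_nrm_sq, h1]
  exact pow_le_pow_left₀ (nrm_nonneg _) (nrm_proj_le _ _) 2

/-- The relative size `α d² |(X Xᵀ - Z Zᵀ)_{kl}| / λ_min` of a step. -/
noncomputable def relStep (Z : Matrix (Fin d) (Fin r) ℝ) (α lam : ℝ)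
    (X : Matrix (Fin d) (Fin r) ℝ) (p : Fin d × Fin d) : ℝ :=
  α * (d : ℝ) ^ 2 * |err Z X p.1 p.2| / lam

lemma sum_relStep_sq (Z X : Matrix (Fin d) (Fin r) ℝ) (α lam : ℝ) :
    ∑ p, relStep Z α lam X p ^ 2 = (α * (d : ℝ) ^ 2 / lam) ^ 2 * f Z X := by
  have : ∀ p, relStep Z α lam X p ^ 2 = (α * (d : ℝ) ^ 2 / lam) ^ 2 * err Z X p.1 p.2 ^ 2 := by
    intro p
    rw [relStep, ← sq_abs (err Z X p.1 p.2)]; ring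
  simp only [this, ← Finset.mul_sum, sum_err_sq]

lemma sum_err_mul_symUnit (Z X : Matrix (Fin d) (Fin r) ℝ) (a b : Fin d → ℝ) :
    ∑ p : Fin d × Fin d, err Z X p.1 p.2 * (a ⬝ᵥ (symUnit p.1 p.2 *ᵥ b)) =
      2 * (a ⬝ᵥ (err Z X *ᵥ b)) := by
  have h1 : ∑ i, ∑ j, err Z X i j * (a i * b j) = a ⬝ᵥ (err Z X *ᵥ b) := by
    simp only [dotProduct, Matrix.mulVec, Finset.mul_sum]
    exact Finset.sum_congr rfl fun _ _ => Finset.sum_congr rfl fun _ _ => by ring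
  have h2 : ∑ i, ∑ j, err Z X i j * (a j * b i) = a ⬝ᵥ (err Z X *ᵥ b) := by
    rw [← h1, Finset.sum_comm]
    exact Finset.sum_congr rfl fun _ _ => Finset.sum_congr rfl fun _ _ => by rw [err_apply_comm]
  simp only [dotProduct_symUnit_mulVec, mul_add, Finset.sum_add_distrib, Fintype.sum_prod_type,
    h1, h2]
  ring

/-- The exponential potential of the relative coherence of row `i`, centred at `1 / 16`. -/
noncomputable def cohPot (θ s : ℝ) (i : Fin d) (X : Matrix (Fin d) (Fin r) ℝ) : ℝ :=
  Real.exp (θ * (g X i / s ^ 2 - 1 / 16))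

namespace NearTruth

lemma relStep_nonneg (H : NearTruth Z X lam ρ s) (hα : 0 < α) (p : Fin d × Fin d) :
    0 ≤ relStep Z α lam X p := by
  have := H.lam_pos
  unfold relStep; positivity

lemma relStep_le (H : NearTruth Z X lam ρ s) (hα : 0 < α) (p : Fin d × Fin d) :
    relStep Z α lam X p ≤ α * (d : ℝ) ^ 2 * ρ := by
  rw [relStep, div_le_iff₀ H.lam_pos]
  have h1 : |err Z X p.1 p.2| ≤ ρ * lam := by
    refine (abs_apply_le_nrm (err Z X p.1) p.2).trans (le_trans ?_ H.sqrt_f_le)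
    refine Real.le_sqrt_of_sq_le ?_
    rw [f_eq_frob]; exact nrm_row_sq_le_frob _ _
  have := mul_le_mul_of_nonneg_left h1 (by positivity : 0 ≤ α * (d : ℝ) ^ 2)
  linarith

lemma abs_stepSize_le_relStep (H : NearTruth Z X lam ρ s) (hα : 0 < α) (p : Fin d × Fin d) :
    |stepSize Z α X p| ≤ 4 * relStep Z α lam X p * ((1 - ρ) * lam) := by
  have h1 : |stepSize Z α X p| = 2 * (relStep Z α lam X p * lam) := by
    have := H.lam_pos
    rw [stepSize, abs_mul, abs_of_nonneg (by positivity), relStep]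
    field_simp
  have h2 := mul_nonneg (H.relStep_nonneg hα p) H.lam_pos.le
  rw [h1]
  nlinarith [H.rho_lt]

lemma nrm_smul_pinv_symUnit_le (H : NearTruth Z X lam ρ s) (hα : 0 < α) (p : Fin d × Fin d)
    {c : ℝ} (hc : ∀ i, nrm (proj X *ᵥ Pi.single i 1) ≤ c) (v : Fin d → ℝ) :
    nrm (stepSize Z α X p • (pinv X *ᵥ (symUnit p.1 p.2 *ᵥ v))) ≤
      8 * relStep Z α lam X p * c * nrm v := by
  have hm := H.m_pos
  have h1 := nrm_pinv_le hm H.bddBelowBy (symUnit p.1 p.2 *ᵥ v)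
  have h2 : nrm (proj X *ᵥ (symUnit p.1 p.2 *ᵥ v)) ≤ 2 * c * nrm v := by
    rw [symUnit_mulVec, Matrix.mulVec_add, Matrix.mulVec_smul, Matrix.mulVec_smul]
    refine (nrm_add_le _ _).trans ?_
    rw [nrm_smul, nrm_smul]
    have k1 := mul_le_mul (abs_apply_le_nrm v p.2) (hc p.1) (nrm_nonneg _) (nrm_nonneg _)
    have k2 := mul_le_mul (abs_apply_le_nrm v p.1) (hc p.2) (nrm_nonneg _) (nrm_nonneg _)
    linarith
  have h3 := H.abs_stepSize_le_relStep hα p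
  rw [nrm_smul]
  have h4 := mul_le_mul_of_nonneg_right h3 (nrm_nonneg (pinv X *ᵥ (symUnit p.1 p.2 *ᵥ v)))
  have h5 := mul_le_mul_of_nonneg_left (h1.trans h2)
    (by linarith [H.relStep_nonneg hα p] : 0 ≤ 4 * relStep Z α lam X p)
  linarith

/-- The vector `b = (1 - P) e_i` can be corrected to a vector orthogonal to the columns of the next
iterate, because that iterate is `(1 - η J R) X` with `η R J` a contraction. -/
lemma exists_corrected (H : NearTruth Z X lam ρ s) (hα : 0 < α) (p : Fin d × Fin d)
    (hτ : 16 * relStep Z α lam X p ≤ 1) (b : Fin d → ℝ) (hb : Xᵀ *ᵥ b = 0) :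
    ∃ n : Fin d → ℝ, n = b + stepSize Z α X p • (pinv X *ᵥ (symUnit p.1 p.2 *ᵥ n)) ∧
      (update Z α X p)ᵀ *ᵥ n = 0 ∧ nrm n ≤ 2 * nrm b := by
  set η := stepSize Z α X p
  set J := symUnit p.1 p.2
  have hc : ∀ v, nrm (η • (pinv X *ᵥ (J *ᵥ v))) ≤ 1 / 2 * nrm v := by
    intro v
    have h := H.nrm_smul_pinv_symUnit_le hα p (fun i => nrm_proj_single_le_one X i) v
    have := mul_le_mul_of_nonneg_right hτ (nrm_nonneg v)
    linarith
  have hA : ∀ v, (1 - η • (pinv X * J)) *ᵥ v = v - η • (pinv X *ᵥ (J *ᵥ v)) := by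
    intro v
    rw [Matrix.sub_mulVec, Matrix.one_mulVec, Matrix.smul_mulVec, Matrix.mulVec_mulVec]
  have hinj : Function.Injective (1 - η • (pinv X * J)).mulVec := by
    refine (injective_iff_map_eq_zero (1 - η • (pinv X * J)).mulVecLin).2 fun v hv => ?_
    rw [Matrix.mulVecLin_apply, hA, sub_eq_zero] at hv
    have h := hc v
    rw [← hv] at h
    exact nrm_eq_zero.1 (le_antisymm (by linarith) (nrm_nonneg v))
  obtain ⟨n, hn⟩ := Matrix.mulVec_surjective_iff_isUnit.2
    (Matrix.mulVec_injective_iff_isUnit.1 hinj) b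
  rw [hA, sub_eq_iff_eq_add] at hn
  refine ⟨n, hn, ?_, ?_⟩
  · have h1 : (update Z α X p)ᵀ *ᵥ n = Xᵀ *ᵥ (n - η • (pinv X *ᵥ (J *ᵥ n))) := by
      rw [update_eq H.isUnit_det, Matrix.transpose_sub, Matrix.transpose_smul,
        Matrix.transpose_mul, Matrix.transpose_mul, pinv_transpose, symUnit_transpose,
        Matrix.sub_mulVec, Matrix.smul_mulVec, Matrix.mulVec_sub, Matrix.mulVec_smul]
      simp only [Matrix.mulVec_mulVec, Matrix.mul_assoc]
      rfl
    rw [h1, sub_eq_iff_eq_add.2 hn, hb]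
  · have h2 := hc n
    have h3 := nrm_add_le b (η • (pinv X *ᵥ (J *ᵥ n)))
    rw [← hn] at h3
    linarith

/-- The coherence after one step, up to a second-order error. -/
lemma g_update_le (H : NearTruth Z X lam ρ s) (hα : 0 < α) (p : Fin d × Fin d)
    (hτ : 16 * relStep Z α lam X p ≤ 1) (i : Fin d) :
    g (update Z α X p) i ≤ g X i - 2 * stepSize Z α X p *
      ((pinv X *ᵥ Pi.single i 1) ⬝ᵥ
        (symUnit p.1 p.2 *ᵥ (Pi.single i 1 - proj X *ᵥ Pi.single i 1))) +
      512 * relStep Z α lam X p ^ 2 * s ^ 2 := by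
  have hm := H.m_pos
  have hs := H.s_pos
  have hτ0 := H.relStep_nonneg hα p
  set τ := relStep Z α lam X p
  set η := stepSize Z α X p with hη
  set J := symUnit p.1 p.2 with hJ
  set e : Fin d → ℝ := Pi.single i 1 with he
  set q := proj X *ᵥ e with hq
  set a := pinv X *ᵥ e with ha
  obtain ⟨n, hn, hn0, hn2⟩ := H.exists_corrected hα p hτ (e - q)
    (transpose_mulVec_sub_proj H.isUnit_det e)
  have hb1 : nrm (e - q) ≤ 1 := by
    have := nrm_sub_proj_le X e
    rwa [he, nrm_single] at this
  set ζ := η • (pinv X *ᵥ (J *ᵥ n)) with hζ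
  have hζn : nrm ζ ≤ 16 * τ * s := by
    refine (H.nrm_smul_pinv_symUnit_le hα p H.coh_X n).trans ?_
    have := mul_le_mul_of_nonneg_left (hn2.trans (by linarith : _ ≤ (2 : ℝ)))
      (by positivity : 0 ≤ 8 * τ * s)
    linarith
  have h1 := g_le_nrm_sub_sq _ i hn0
  have h2 : e - n = q - ζ := by rw [hn]; abel
  have h3 : q ⬝ᵥ ζ = η * (a ⬝ᵥ (J *ᵥ (e - q))) + η * (a ⬝ᵥ (J *ᵥ ζ)) := by
    have : n = (e - q) + ζ := hn
    rw [hζ, dotProduct_smul, ← pinv_mulVec_dotProduct, hq, pinv_mulVec_proj, ← hq, ← ha, ← hζ,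
      smul_eq_mul, ← mul_add, ← dotProduct_add, ← Matrix.mulVec_add, ← this]
  have h4 : |η * (a ⬝ᵥ (J *ᵥ ζ))| ≤ 128 * τ ^ 2 * s ^ 2 := by
    have ha1 : ∀ k, (1 - ρ) * lam * |a k| ≤ s := by
      intro k
      refine (abs_pinv_mulVec_apply_le hm H.bddBelowBy e k).trans ?_
      have := mul_le_mul (nrm_proj_single_le_one X k) (H.coh_X i) (nrm_nonneg _) zero_le_one
      linarith
    have h5 : |a ⬝ᵥ (J *ᵥ ζ)| ≤ (|a p.1| + |a p.2|) * nrm ζ := by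
      rw [hJ, dotProduct_symUnit_mulVec]
      refine (abs_add_le _ _).trans ?_
      rw [abs_mul, abs_mul]
      have k1 := mul_le_mul_of_nonneg_left (abs_apply_le_nrm ζ p.2) (abs_nonneg (a p.1))
      have k2 := mul_le_mul_of_nonneg_left (abs_apply_le_nrm ζ p.1) (abs_nonneg (a p.2))
      linarith
    rw [abs_mul]
    calc |η| * |a ⬝ᵥ (J *ᵥ ζ)|
        ≤ (4 * τ * ((1 - ρ) * lam)) * ((|a p.1| + |a p.2|) * nrm ζ) :=
          mul_le_mul (H.abs_stepSize_le_relStep hα p) h5 (abs_nonneg _) (by positivity)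
      _ = 4 * τ * nrm ζ * ((1 - ρ) * lam * |a p.1| + (1 - ρ) * lam * |a p.2|) := by ring
      _ ≤ 4 * τ * nrm ζ * (2 * s) :=
          mul_le_mul_of_nonneg_left (by linarith [ha1 p.1, ha1 p.2])
            (mul_nonneg (by positivity) (nrm_nonneg _))
      _ = 8 * τ * s * nrm ζ := by ring
      _ ≤ 8 * τ * s * (16 * τ * s) := mul_le_mul_of_nonneg_left hζn (by positivity)
      _ = 128 * τ ^ 2 * s ^ 2 := by ring
  have h5 : nrm ζ ^ 2 ≤ 256 * τ ^ 2 * s ^ 2 := by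
    have := pow_le_pow_left₀ (nrm_nonneg ζ) hζn 2
    linarith
  have h6 : nrm (q - ζ) ^ 2 = g X i - 2 * (q ⬝ᵥ ζ) + nrm ζ ^ 2 := by
    rw [g_eq_nrm_sq, nrm_sq, nrm_sq, nrm_sq, sub_dotProduct, dotProduct_sub, dotProduct_sub,
      dotProduct_comm ζ q]
    ring
  rw [h2, h6, h3] at h1
  linarith [(abs_le.1 h4).1]

lemma abs_first_order_le (H : NearTruth Z X lam ρ s) (hα : 0 < α) (p : Fin d × Fin d)
    (i : Fin d) :
    |stepSize Z α X p * ((pinv X *ᵥ Pi.single i 1) ⬝ᵥ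
        (symUnit p.1 p.2 *ᵥ (Pi.single i 1 - proj X *ᵥ Pi.single i 1)))| ≤
      8 * relStep Z α lam X p * s ^ 2 := by
  set a := pinv X *ᵥ Pi.single i 1
  set b : Fin d → ℝ := Pi.single i 1 - proj X *ᵥ Pi.single i 1
  have hτ0 := H.relStep_nonneg hα p
  have hb1 : ∀ k, |b k| ≤ 1 := by
    intro k
    refine (abs_apply_le_nrm b k).trans ((nrm_sub_proj_le X _).trans (nrm_single i).le)
  have h5 : |a ⬝ᵥ (symUnit p.1 p.2 *ᵥ b)| ≤ |a p.1| + |a p.2| := by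
    rw [dotProduct_symUnit_mulVec]
    refine (abs_add_le _ _).trans ?_
    rw [abs_mul, abs_mul]
    exact add_le_add (mul_le_of_le_one_right (abs_nonneg _) (hb1 _))
      (mul_le_of_le_one_right (abs_nonneg _) (hb1 _))
  rw [abs_mul]
  calc _ ≤ (4 * relStep Z α lam X p * ((1 - ρ) * lam)) * (|a p.1| + |a p.2|) :=
        mul_le_mul (H.abs_stepSize_le_relStep hα p) h5 (abs_nonneg _)
          (mul_nonneg (by positivity) H.m_pos.le)
    _ = 4 * relStep Z α lam X p * ((1 - ρ) * lam * |a p.1| + (1 - ρ) * lam * |a p.2|) := by ring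
    _ ≤ 4 * relStep Z α lam X p * (2 * s ^ 2) :=
        mul_le_mul_of_nonneg_left (by linarith [H.abs_pinv_le p.1 i, H.abs_pinv_le p.2 i])
          (by positivity)
    _ = _ := by ring

/-- On average the exponential potential relaxes towards `1`, at rate `4 (1 - 2ρ) / (1 - ρ) α`, up
to a noise term proportional to the objective. -/
lemma sum_cohPot_update_le (H : NearTruth Z X lam ρ s) (hα : 0 < α) {θ q : ℝ} (hθ : 1 ≤ θ)
    (hτ : 32 * (θ * (α * (d : ℝ) ^ 2 * ρ)) ≤ 1) (hq : f Z X ≤ q * (ρ * lam) ^ 2) (i : Fin d) :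
    ∑ p : Fin d × Fin d, cohPot θ s i (update Z α X p) ≤
      (d : ℝ) ^ 2 * ((1 - 4 * (1 - 2 * ρ) / (1 - ρ) * α +
        1536 * θ ^ 2 * (α ^ 2 * (d : ℝ) ^ 2 * ρ ^ 2 * q)) * cohPot θ s i X +
        4 * (1 - 2 * ρ) / (1 - ρ) * α) := by
  have hs := H.s_pos
  have hlam := H.lam_pos
  have hρ0 := H.rho_nonneg
  have hρ1 := H.rho_lt
  set ε := 4 * (1 - 2 * ρ) / (1 - ρ) * α with hε
  have hε0 : 0 ≤ ε := mul_nonneg (div_nonneg (by linarith) (by linarith)) hα.le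
  set y := g X i / s ^ 2 with hy
  set a := pinv X *ᵥ Pi.single i 1 with ha
  set b : Fin d → ℝ := Pi.single i 1 - proj X *ᵥ Pi.single i 1 with hb
  set τ : Fin d × Fin d → ℝ := fun p => relStep Z α lam X p with hτd
  have hτ0 : ∀ p, 0 ≤ τ p := fun p => H.relStep_nonneg hα p
  have hτle : ∀ p, 32 * (θ * τ p) ≤ 1 := fun p => by
    have := mul_le_mul_of_nonneg_left (H.relStep_le hα p) (by linarith : 0 ≤ θ)
    linarith
  have hτ1 : ∀ p, 32 * τ p ≤ 1 := fun p => by nlinarith [hτ0 p, hτle p]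
  set w : Fin d × Fin d → ℝ := fun p => stepSize Z α X p * (a ⬝ᵥ (symUnit p.1 p.2 *ᵥ b)) / s ^ 2
    with hw
  set x : Fin d × Fin d → ℝ := fun p => -2 * w p + 512 * τ p ^ 2 with hx
  have hstep : ∀ p, g (update Z α X p) i / s ^ 2 ≤ y + x p := by
    intro p
    have h := H.g_update_le hα p (by linarith [hτ0 p, hτ1 p]) i
    rw [div_le_iff₀ (by positivity)]
    have : (y + x p) * s ^ 2 = g X i - 2 * stepSize Z α X p * (a ⬝ᵥ (symUnit p.1 p.2 *ᵥ b)) +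
      512 * τ p ^ 2 * s ^ 2 := by
      simp only [hy, hx, hw]; field_simp; ring
    rw [this]; exact h
  have hwle : ∀ p, |w p| ≤ 8 * τ p := by
    intro p
    simp only [hw]
    rw [abs_div, abs_of_pos (by positivity : 0 < s ^ 2), div_le_iff₀ (by positivity)]
    exact H.abs_first_order_le hα p i
  have hxle : ∀ p, |x p| ≤ 32 * τ p := by
    intro p
    have h1 := abs_le.1 (hwle p)
    have h2 := mul_le_mul_of_nonneg_left (hτ1 p) (hτ0 p)
    rw [abs_le]
    constructor <;> simp only [hx] <;> nlinarith [hτ0 p]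
  have hterm : ∀ p, cohPot θ s i (update Z α X p) ≤
      cohPot θ s i X * (1 + θ * x p + 1024 * θ ^ 2 * τ p ^ 2) := by
    intro p
    have h1 : |θ * x p| ≤ 1 := by
      rw [abs_mul, abs_of_pos (by linarith : 0 < θ)]
      have := mul_le_mul_of_nonneg_left (hxle p) (by linarith : 0 ≤ θ)
      linarith [hτle p]
    have h2 := (abs_le.1 (Real.abs_exp_sub_one_sub_id_le h1)).2
    have h3 : (θ * x p) ^ 2 ≤ 1024 * θ ^ 2 * τ p ^ 2 := by
      have h4 := pow_le_pow_left₀ (abs_nonneg _) (hxle p) 2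
      rw [sq_abs] at h4
      have := mul_le_mul_of_nonneg_left h4 (sq_nonneg θ)
      linarith
    have h5 : cohPot θ s i (update Z α X p) ≤ cohPot θ s i X * Real.exp (θ * x p) := by
      rw [cohPot, cohPot, ← Real.exp_add]
      refine Real.exp_le_exp.2 ?_
      have := mul_le_mul_of_nonneg_left (hstep p) (by linarith : 0 ≤ θ)
      linarith
    exact h5.trans (mul_le_mul_of_nonneg_left (by linarith) (Real.exp_nonneg _))
  have hsumτ : ∑ p, τ p ^ 2 ≤ (d : ℝ) ^ 2 * (α ^ 2 * (d : ℝ) ^ 2 * ρ ^ 2 * q) := by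
    rw [hτd, sum_relStep_sq]
    refine (mul_le_mul_of_nonneg_left hq (sq_nonneg _)).trans_eq ?_
    field_simp
  have hsumw : ∑ p, -2 * w p ≤ (d : ℝ) ^ 2 * (ε * (1 / 16 - y)) := by
    have h1 : ∑ p, -2 * w p = (d : ℝ) ^ 2 * (8 * α / s ^ 2 * -(a ⬝ᵥ (err Z X *ᵥ b))) := by
      have : ∀ p, -2 * w p = -(4 * α * (d : ℝ) ^ 2 / s ^ 2) *
          (err Z X p.1 p.2 * (a ⬝ᵥ (symUnit p.1 p.2 *ᵥ b))) := by
        intro p; simp only [hw, stepSize]; ring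
      simp only [this, ← Finset.mul_sum]
      rw [sum_err_mul_symUnit]; ring
    have h2 := neg_dotProduct_err_le H.lam_pos hρ0 (by linarith) H.below H.f_le i
    rw [← g_eq_nrm_sq] at h2
    have h3 : nrm (proj X *ᵥ Pi.single i 1) * nrm (proj Z *ᵥ Pi.single i 1) ≤
        (1 - 2 * ρ) * (g X i / 2 + s ^ 2 / 32) := by
      have k1 := mul_le_mul_of_nonneg_left (H.coh_Z i) (nrm_nonneg (proj X *ᵥ Pi.single i 1))
      have k2 := g_eq_nrm_sq X i
      have k3 : nrm (proj X *ᵥ Pi.single i 1) * s / 4 ≤ g X i / 2 + s ^ 2 / 32 := by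
        rw [k2]; nlinarith [sq_nonneg (nrm (proj X *ᵥ Pi.single i 1) - s / 4)]
      have k4 := mul_le_mul_of_nonneg_left k3 (by linarith : 0 ≤ 1 - 2 * ρ)
      linarith
    have h4 : -(a ⬝ᵥ (err Z X *ᵥ b)) ≤ (1 - 2 * ρ) / (1 - ρ) / 2 * (s ^ 2 / 16 - g X i) := by
      have : 0 < 1 - ρ := by linarith
      rw [← mul_le_mul_iff_left₀ this]
      refine h2.trans ?_
      have e : (1 - 2 * ρ) / (1 - ρ) / 2 * (s ^ 2 / 16 - g X i) * (1 - ρ) =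
        (1 - 2 * ρ) * (s ^ 2 / 16 - g X i) / 2 := by field_simp
      rw [e]; linarith
    rw [h1]
    refine mul_le_mul_of_nonneg_left ?_ (sq_nonneg _)
    refine (mul_le_mul_of_nonneg_left h4 (by positivity)).trans_eq ?_
    have : 1 - ρ ≠ 0 := by linarith
    simp only [hε, hy]; field_simp; ring
  set v := α ^ 2 * (d : ℝ) ^ 2 * ρ ^ 2 * q with hv
  set W := cohPot θ s i X with hW
  have hW0 : 0 < W := Real.exp_pos _
  have hv0 : 0 ≤ (d : ℝ) ^ 2 * v := (Finset.sum_nonneg fun p _ => sq_nonneg (τ p)).trans hsumτ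
  -- convexity: `exp u * (1 - ε u) ≤ (1 - ε) exp u + ε`
  have hconv : W * (1 + θ * (ε * (1 / 16 - y))) ≤ (1 - ε) * W + ε := by
    have h1 : W * (1 - θ * (y - 1 / 16)) ≤ 1 := by
      have h2 := Real.add_one_le_exp (-(θ * (y - 1 / 16)))
      have h3 : W * Real.exp (-(θ * (y - 1 / 16))) = 1 := by
        rw [hW, cohPot, ← Real.exp_add]; simp [hy]
      refine le_trans ?_ h3.le
      exact mul_le_mul_of_nonneg_left (by linarith) hW0.le
    have := mul_le_mul_of_nonneg_left h1 hε0
    linarith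
  calc ∑ p, cohPot θ s i (update Z α X p)
      ≤ ∑ p, W * (1 + θ * x p + 1024 * θ ^ 2 * τ p ^ 2) := Finset.sum_le_sum fun p _ => hterm p
    _ = W * ((d : ℝ) ^ 2 + θ * ∑ p, -2 * w p + (512 * θ + 1024 * θ ^ 2) * ∑ p, τ p ^ 2) := by
        rw [← Finset.mul_sum]
        simp only [hx, mul_add, Finset.sum_add_distrib, ← Finset.mul_sum]
        simp [sq]
        ring
    _ ≤ W * ((d : ℝ) ^ 2 + θ * ((d : ℝ) ^ 2 * (ε * (1 / 16 - y))) +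
          1536 * θ ^ 2 * ((d : ℝ) ^ 2 * v)) := by
        refine mul_le_mul_of_nonneg_left ?_ hW0.le
        have k1 := mul_le_mul_of_nonneg_left hsumw (by linarith : 0 ≤ θ)
        have k2 := mul_le_mul_of_nonneg_left hsumτ
          (by positivity : 0 ≤ 512 * θ + 1024 * θ ^ 2)
        have k3 : (512 * θ + 1024 * θ ^ 2) * ((d : ℝ) ^ 2 * v) ≤
            1536 * θ ^ 2 * ((d : ℝ) ^ 2 * v) :=
          mul_le_mul_of_nonneg_right (by nlinarith) hv0
        linarith
    _ = (d : ℝ) ^ 2 * (W * (1 + θ * (ε * (1 / 16 - y))) + 1536 * θ ^ 2 * v * W) := by ring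
    _ ≤ (d : ℝ) ^ 2 * ((1 - ε + 1536 * θ ^ 2 * v) * W + ε) := by
        refine mul_le_mul_of_nonneg_left ?_ (sq_nonneg _)
        linarith

end NearTruth
end Coherence

/-! ### Condition number and coherence of the ground truth -/

section GroundTruth

variable {d r : ℕ} {Z : Matrix (Fin d) (Fin r) ℝ}

lemma nrm_mulVec_sq_eq_sum (Z : Matrix (Fin d) (Fin r) ℝ) (w : Fin r → ℝ) :
    nrm (Z *ᵥ w) ^ 2 = ∑ k, (Matrix.isHermitian_conjTranspose_mul_self Z).eigenvalues k *
      inner ℝ ((Matrix.isHermitian_conjTranspose_mul_self Z).eigenvectorBasis k)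
        (WithLp.toLp 2 w) ^ 2 := by
  set hA := Matrix.isHermitian_conjTranspose_mul_self Z
  set b := hA.eigenvectorBasis
  have h1 : nrm (Z *ᵥ w) ^ 2 = inner ℝ (WithLp.toLp 2 w) (WithLp.toLp 2 ((Zᴴ * Z) *ᵥ w)) := by
    rw [EuclideanSpace.inner_toLp_toLp, nrm_sq, ← Matrix.mulVec_mulVec,
      Matrix.conjTranspose_eq_transpose_of_trivial]
    simp only [star_trivial]
    rw [dotProduct_mulVec_transpose]
  rw [h1, ← b.sum_inner_mul_inner]
  refine Finset.sum_congr rfl fun k _ => ?_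
  have h2 : inner ℝ (b k) (WithLp.toLp 2 ((Zᴴ * Z) *ᵥ w)) =
      hA.eigenvalues k * inner ℝ (b k) (WithLp.toLp 2 w) := by
    have h3 : (Zᴴ * Z) *ᵥ (b k : Fin r → ℝ) = hA.eigenvalues k • (b k : Fin r → ℝ) :=
      hA.mulVec_eigenvectorBasis k
    have h4 : ∀ v, inner ℝ (b k) (WithLp.toLp 2 v) = v ⬝ᵥ (b k : Fin r → ℝ) := fun v => by
      simp [PiLp.inner_apply, dotProduct]
    have h5 : (Zᴴ * Z)ᵀ = Zᴴ * Z := by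
      rw [← Matrix.conjTranspose_eq_transpose_of_trivial]; exact hA
    have h6 := dotProduct_mulVec_transpose (Zᴴ * Z) w (b k)
    rw [h5, h3, dotProduct_smul, smul_eq_mul] at h6
    rw [h4, h4, h6]
  rw [h2, real_inner_comm]
  ring

lemma nrm_sq_eq_sum_inner (Z : Matrix (Fin d) (Fin r) ℝ) (w : Fin r → ℝ) :
    nrm w ^ 2 = ∑ k, inner ℝ ((Matrix.isHermitian_conjTranspose_mul_self Z).eigenvectorBasis k)
        (WithLp.toLp 2 w) ^ 2 := by
  rw [nrm, ← OrthonormalBasis.sum_sq_norm_inner_right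
    (Matrix.isHermitian_conjTranspose_mul_self Z).eigenvectorBasis]
  simp

lemma bddBelowBy_gramMin (Z : Matrix (Fin d) (Fin r) ℝ) : BddBelowBy Z (gramMin Z) := by
  intro w
  rw [nrm_mulVec_sq_eq_sum, nrm_sq_eq_sum_inner Z w, Finset.mul_sum]
  exact Finset.sum_le_sum fun k _ => mul_le_mul_of_nonneg_right
    (ciInf_le (Set.finite_range _).bddBelow k) (sq_nonneg _)

lemma nrm_mulVec_sq_le_gramMax (Z : Matrix (Fin d) (Fin r) ℝ) (w : Fin r → ℝ) :
    nrm (Z *ᵥ w) ^ 2 ≤ gramMax Z * nrm w ^ 2 := by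
  rw [nrm_mulVec_sq_eq_sum, nrm_sq_eq_sum_inner Z w, Finset.mul_sum]
  exact Finset.sum_le_sum fun k _ => mul_le_mul_of_nonneg_right
    (le_ciSup (Set.finite_range _).bddAbove k) (sq_nonneg _)

lemma pos_of_sigmaMax_eq_one (hσ : sigmaMax Z = 1) : 0 < r := by
  by_contra h
  have : sigmaMax Z = 0 :=
    LinearMap.singularValues_of_finrank_le _ (by rw [finrank_euclideanSpace_fin]; omega)
  linarith

lemma gramMin_pos (hr : 0 < r) (hZ : (Z * Zᵀ).rank = r) : 0 < gramMin Z := by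
  have : Nonempty (Fin r) := ⟨⟨0, hr⟩⟩
  obtain ⟨k, hk⟩ := exists_eq_ciInf_of_finite
    (f := (Matrix.isHermitian_conjTranspose_mul_self Z).eigenvalues)
  rw [gramMin, ← hk]
  refine lt_of_le_of_ne (Matrix.eigenvalues_conjTranspose_mul_self_nonneg Z k) fun h0 => ?_
  have h1 := (Matrix.isHermitian_conjTranspose_mul_self Z).rank_eq_card_non_zero_eigs
  rw [Matrix.rank_conjTranspose_mul_self, ← Matrix.rank_self_mul_transpose, hZ] at h1
  have h2 := Fintype.card_subtype_lt
    (p := fun i => (Matrix.isHermitian_conjTranspose_mul_self Z).eigenvalues i ≠ 0) (x := k)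
    (by simpa using h0.symm)
  rw [Fintype.card_fin] at h2
  omega

lemma one_le_gramMax (hσ : sigmaMax Z = 1) : 1 ≤ gramMax Z := by
  have hr := pos_of_sigmaMax_eq_one hσ
  have h := LinearMap.hasEigenvalue_adjoint_comp_self_sq_singularValues
    (T := Matrix.toEuclideanLin Z) (n := 0) (by rw [finrank_euclideanSpace_fin]; exact hr)
  obtain ⟨v, hv⟩ := h.exists_hasEigenvector
  have h1 : nrm (Z *ᵥ v.ofLp) ^ 2 = nrm v.ofLp ^ 2 := by
    have e1 := hv.apply_eq_smul
    change sigmaMax Z = 1 at hσ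
    rw [sigmaMax] at hσ
    have e2 : inner ℝ (Matrix.toEuclideanLin Z v) (Matrix.toEuclideanLin Z v) =
        inner ℝ v v := by
      rw [← LinearMap.adjoint_inner_right, ← LinearMap.comp_apply, e1, hσ]
      simp
    rw [real_inner_self_eq_norm_sq, real_inner_self_eq_norm_sq] at e2
    exact e2
  have h2 := nrm_mulVec_sq_le_gramMax Z v.ofLp
  have h3 : 0 < nrm v.ofLp ^ 2 := by
    have : nrm v.ofLp ≠ 0 := fun h0 => hv.2 (by
      have := nrm_eq_zero.1 h0
      ext i; exact congrFun this i)
    positivity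
  rw [h1] at h2
  by_contra! hlt
  nlinarith

lemma kappa_inv_pos (hZ : (Z * Zᵀ).rank = r) (hσ : sigmaMax Z = 1) : 0 < (kappa Z)⁻¹ := by
  have h1 := gramMin_pos (pos_of_sigmaMax_eq_one hσ) hZ
  have h2 := one_le_gramMax hσ
  rw [kappa]; positivity

/-- Since `λ_max(Zᵀ Z) = 1`, the inverse condition number bounds `Zᵀ Z` from below. -/
lemma bddBelowBy_kappa_inv (hZ : (Z * Zᵀ).rank = r) (hσ : sigmaMax Z = 1) :
    BddBelowBy Z (kappa Z)⁻¹ := by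
  have h1 := gramMin_pos (pos_of_sigmaMax_eq_one hσ) hZ
  have h2 := one_le_gramMax hσ
  have h3 : (kappa Z)⁻¹ ≤ gramMin Z := by
    rw [kappa, inv_div]; exact div_le_self h1.le h2
  exact fun w => (mul_le_mul_of_nonneg_right h3 (sq_nonneg _)).trans (bddBelowBy_gramMin Z w)

lemma g_le_coherence (hr : 0 < r) (i : Fin d) :
    g Z i ≤ coherence Z * (r : ℝ) / (d : ℝ) := by
  have hd : (d : ℝ) ≠ 0 := by exact_mod_cast (Fin.pos i).ne'
  have hr' : (r : ℝ) ≠ 0 := by exact_mod_cast hr.ne'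
  have e : coherence Z * (r : ℝ) / (d : ℝ) = ⨆ i : Fin d, ‖WithLp.toLp 2 (whiten Z i)‖ ^ 2 := by
    rw [coherence]; field_simp
  rw [e, ← norm_whiten_sq]
  exact le_ciSup (f := fun i => ‖WithLp.toLp 2 (whiten Z i)‖ ^ 2) (Set.finite_range _).bddAbove i

lemma sum_g_eq (hZ : IsUnit (Zᵀ * Z).det) : ∑ i, g Z i = r := by
  have h1 : ∑ i, g Z i = (Z * (Zᵀ * Z)⁻¹ * Zᵀ).trace := rfl
  rw [h1, Matrix.trace_mul_comm, ← Matrix.mul_assoc, Matrix.mul_nonsing_inv _ hZ]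
  simp

lemma one_le_mul_coherence (hZ : (Z * Zᵀ).rank = r) (hσ : sigmaMax Z = 1) :
    1 ≤ (d : ℝ) * (coherence Z * (r : ℝ) / (d : ℝ)) := by
  have hr := pos_of_sigmaMax_eq_one hσ
  have h1 := sum_g_eq ((bddBelowBy_kappa_inv hZ hσ).isUnit_det (kappa_inv_pos hZ hσ))
  have h2 : ∑ i, g Z i ≤ ∑ _i : Fin d, coherence Z * (r : ℝ) / (d : ℝ) :=
    Finset.sum_le_sum fun i _ => g_le_coherence hr i
  rw [h1, Finset.sum_const, Finset.card_univ, Fintype.card_fin, nsmul_eq_mul] at h2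
  have h3 : (1 : ℝ) ≤ r := by exact_mod_cast hr
  linarith

lemma sixteen_le_mul_gMax (hZ : (Z * Zᵀ).rank = r) (hσ : sigmaMax Z = 1) {ρ : ℝ} (hρ : 0 ≤ ρ)
    (hρ1 : ρ < 1 / 2) : 16 ≤ (d : ℝ) * gMax Z ρ := by
  have h1 := one_le_mul_coherence hZ hσ
  have h2 : (16 : ℝ) ≤ 2 ^ 4 / (1 - 2 * ρ) ^ 2 := by
    rw [le_div_iff₀ (by nlinarith)]; nlinarith
  rw [gMax]
  calc (16 : ℝ) ≤ 2 ^ 4 / (1 - 2 * ρ) ^ 2 * 1 := by linarith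
    _ ≤ 2 ^ 4 / (1 - 2 * ρ) ^ 2 * ((d : ℝ) * (coherence Z * (r : ℝ) / (d : ℝ))) :=
      mul_le_mul_of_nonneg_left h1 (by positivity)
    _ = _ := by ring

lemma gMax_pos (hZ : (Z * Zᵀ).rank = r) (hσ : sigmaMax Z = 1) {ρ : ℝ} (hρ : 0 ≤ ρ)
    (hρ1 : ρ < 1 / 2) : 0 < gMax Z ρ := by
  have h := sixteen_le_mul_gMax hZ hσ hρ hρ1
  by_contra! h0
  nlinarith [mul_nonneg (Nat.cast_nonneg (α := ℝ) d) (neg_nonneg.2 h0)]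

lemma fMax_eq (Z : Matrix (Fin d) (Fin r) ℝ) (ρ : ℝ) : fMax Z ρ = (ρ * (kappa Z)⁻¹) ^ 2 := by
  rw [fMax, div_eq_mul_inv]

/-- The levels `fMax` and `gMax` of the theorem meet the hypotheses of the one-step analysis. -/
lemma nearTruth_of_le (hZ : (Z * Zᵀ).rank = r) (hσ : sigmaMax Z = 1) {ρ : ℝ} (hρ : 0 ≤ ρ)
    (hρ1 : ρ < 1 / 2) {X : Matrix (Fin d) (Fin r) ℝ} (hf : f Z X ≤ fMax Z ρ)
    (hg : ∀ i, g X i ≤ gMax Z ρ) : NearTruth Z X (kappa Z)⁻¹ ρ √(gMax Z ρ) where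
  lam_pos := kappa_inv_pos hZ hσ
  rho_nonneg := hρ
  rho_lt := hρ1
  below := bddBelowBy_kappa_inv hZ hσ
  f_le := by rwa [← fMax_eq]
  s_pos := Real.sqrt_pos.2 (gMax_pos hZ hσ hρ hρ1)
  coh_X i := Real.le_sqrt_of_sq_le (by rw [← g_eq_nrm_sq]; exact hg i)
  coh_Z i := by
    have h1 := g_le_coherence (Z := Z) (pos_of_sigmaMax_eq_one hσ) i
    have h2 : (1 - 2 * ρ) * √(gMax Z ρ) / 4 = √((1 - 2 * ρ) ^ 2 / 16 * gMax Z ρ) := by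
      rw [Real.sqrt_mul (by positivity), Real.sqrt_div (sq_nonneg _), Real.sqrt_sq (by linarith),
        show (16 : ℝ) = 4 ^ 2 by norm_num, Real.sqrt_sq (by norm_num)]
      ring
    rw [h2]
    refine Real.le_sqrt_of_sq_le ?_
    rw [← g_eq_nrm_sq, gMax]
    refine h1.trans_eq ?_
    have : 1 - 2 * ρ ≠ 0 := by linarith
    field_simp
    norm_num

end GroundTruth

/-! ### Chains driven by independent uniform samples -/

section Chain

variable {ι S Ω : Type*} [MeasurableSpace Ω] {P : Measure Ω} [IsProbabilityMeasure P]
  {idx : ℕ → Ω → ι}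

lemma exists_eq_comp_history (P : Measure Ω) [IsProbabilityMeasure P] (idx : ℕ → Ω → ι) (t : ℕ)
    {β : Type*} (F : (ℕ → ι) → β)
    (hF : ∀ x y, (∀ j < t, x j = y j) → F x = F y) :
    ∃ Ψ : (Finset.range t → ι) → β, ∀ ω, F (fun j => idx j ω) = Ψ fun j => idx j ω := by
  obtain ⟨ω₀⟩ : Nonempty Ω := P.nonempty_of_neZero
  classical
  refine ⟨fun u => F fun j => if h : j ∈ Finset.range t then u ⟨j, h⟩ else idx j ω₀, fun ω => ?_⟩
  exact hF _ _ fun j hj => by simp [hj]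

open scoped Classical in
/-- The potential `V` at time `t` along a chain, killed once the chain has left the good set at an
earlier time. -/
noncomputable def stopped (good : ℕ → S → Prop) (V : ℕ → S → ℝ) (x : (ℕ → ι) → ℕ → S) (t : ℕ)
    (u : ℕ → ι) : ℝ :=
  if ∀ j < t, good j (x u j) then V t (x u t) else 0

lemma stopped_of_good {good : ℕ → S → Prop} {V : ℕ → S → ℝ} {x : (ℕ → ι) → ℕ → S} {t : ℕ}
    {u : ℕ → ι} (h : ∀ j < t, good j (x u j)) : stopped good V x t u = V t (x u t) :=
  if_pos h

lemma stopped_of_not {good : ℕ → S → Prop} {V : ℕ → S → ℝ} {x : (ℕ → ι) → ℕ → S} {t : ℕ}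
    {u : ℕ → ι} (h : ¬ ∀ j < t, good j (x u j)) : stopped good V x t u = 0 :=
  if_neg h

lemma stopped_nonneg {good : ℕ → S → Prop} {V : ℕ → S → ℝ} (hV : ∀ t X, 0 ≤ V t X)
    (x : (ℕ → ι) → ℕ → S) (t : ℕ) (u : ℕ → ι) : 0 ≤ stopped good V x t u := by
  unfold stopped; split_ifs; exacts [hV _ _, le_rfl]

lemma chain_congr {step : S → ι → S} {x₀ : S} {x : (ℕ → ι) → ℕ → S} (hx0 : ∀ u, x u 0 = x₀)
    (hx : ∀ u t, x u (t + 1) = step (x u t) (u t)) {t : ℕ} {u v : ℕ → ι}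
    (h : ∀ j < t, u j = v j) : x u t = x v t := by
  induction t with
  | zero => rw [hx0, hx0]
  | succ t ih => rw [hx, hx, ih fun j hj => h j (by omega), h t (by omega)]

lemma stopped_congr {good : ℕ → S → Prop} {V : ℕ → S → ℝ} {step : S → ι → S} {x₀ : S}
    {x : (ℕ → ι) → ℕ → S} (hx0 : ∀ u, x u 0 = x₀)
    (hx : ∀ u t, x u (t + 1) = step (x u t) (u t)) (t : ℕ) (u v : ℕ → ι)
    (h : ∀ j < t, u j = v j) : stopped good V x t u = stopped good V x t v := by
  have h1 : ∀ j ≤ t, x u j = x v j := fun j hj =>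
    chain_congr hx0 hx fun i hi => h i (by omega)
  have h2 : (∀ j < t, good j (x u j)) ↔ ∀ j < t, good j (x v j) :=
    forall₂_congr fun j hj => by rw [h1 j hj.le]
  by_cases hu : ∀ j < t, good j (x u j)
  · rw [stopped_of_good hu, stopped_of_good (h2.1 hu), h1 t le_rfl]
  · rw [stopped_of_not hu, stopped_of_not (mt h2.2 hu)]

/-- A union bound over the first time at which a chain leaves the good set. -/
lemma one_sub_le_measureReal_good {good : ℕ → S → Prop} (y : ℕ → Ω → S) {T : ℕ} {δ : ℝ}
    (h0 : ∀ ω, good 0 (y 0 ω))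
    (h : ∀ t, 1 ≤ t → t ≤ T → P.real {ω | (∀ j < t, good j (y j ω)) ∧ ¬ good t (y t ω)} ≤ δ) :
    1 - T * δ ≤ P.real {ω | ∀ t ≤ T, good t (y t ω)} := by
  set G := {ω | ∀ t ≤ T, good t (y t ω)} with hG
  set B : ℕ → Set Ω := fun t => {ω | (∀ j < t, good j (y j ω)) ∧ ¬ good t (y t ω)} with hB
  have hcov : (Set.univ : Set Ω) ⊆ G ∪ ⋃ t ∈ Finset.Icc 1 T, B t := by
    intro ω _
    by_cases hω : ω ∈ G
    · exact Or.inl hω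
    · right
      simp only [hG, Set.mem_ofPred_eq, not_forall] at hω
      classical
      have hex : ∃ t, ¬ good t (y t ω) := by
        obtain ⟨t, _, ht⟩ := hω; exact ⟨t, ht⟩
      refine Set.mem_biUnion (x := Nat.find hex) ?_ ⟨fun j hj => ?_, Nat.find_spec hex⟩
      · rw [Finset.coe_Icc, Set.mem_Icc]
        constructor
        · rw [Nat.one_le_iff_ne_zero]
          intro h'
          have := Nat.find_spec hex
          rw [h'] at this
          exact this (h0 ω)
        · obtain ⟨t, htT, ht⟩ := hω
          exact (Nat.find_min' hex ht).trans htT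
      · exact not_not.1 (Nat.find_min hex hj)
  have h1 : (1 : ℝ) ≤ P.real (G ∪ ⋃ t ∈ Finset.Icc 1 T, B t) := by
    rw [← probReal_univ (μ := P)]; exact measureReal_mono hcov
  have h2 : P.real (⋃ t ∈ Finset.Icc 1 T, B t) ≤ T * δ := by
    refine (measureReal_biUnion_finset_le _ _).trans ?_
    refine (Finset.sum_le_card_nsmul _ _ δ fun t ht => ?_).trans ?_
    · rw [Finset.mem_Icc] at ht; exact h t ht.1 ht.2
    · simp
  linarith [measureReal_union_le (μ := P) G (⋃ t ∈ Finset.Icc 1 T, B t)]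

variable [MeasurableSpace ι] [MeasurableSingletonClass ι] [Fintype ι]

lemma integrable_history (hidx : ∀ t, Measurable (idx t)) (t : ℕ) (F : (ℕ → ι) → ℝ)
    (hF : ∀ x y, (∀ j < t, x j = y j) → F x = F y) :
    Integrable (fun ω => F fun j => idx j ω) P := by
  obtain ⟨Ψ, hΨ⟩ := exists_eq_comp_history P idx t F hF
  simp only [hΨ]
  have hH : Measurable fun ω => fun j : Finset.range t => idx j ω :=
    measurable_pi_lambda _ fun j => hidx j
  have := Measure.isProbabilityMeasure_map (μ := P) hH.aemeasurable
  exact (Integrable.of_finite (f := Ψ) (μ := P.map _)).comp_measurable hH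

/-- The sample of time `t` is independent of the earlier ones, hence can be averaged over. -/
lemma integral_eq_average (hidx : ∀ t, Measurable (idx t))
    (hunif : ∀ t, P.map (idx t) = uniformOn Set.univ) (hind : iIndepFun idx P) (t : ℕ)
    (Φ : (ℕ → ι) → ι → ℝ) (hΦ : ∀ x y, (∀ j < t, x j = y j) → Φ x = Φ y) :
    ∫ ω, Φ (fun j => idx j ω) (idx t ω) ∂P =
      (∑ p, ∫ ω, Φ (fun j => idx j ω) p ∂P) / Fintype.card ι := by
  classical
  obtain ⟨Ψ, hΨ⟩ := exists_eq_comp_history P idx t Φ hΦ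
  have hind2 := hind.indepFun_finset (Finset.range t) {t} (by simp) hidx
  have hprob : ∀ p, ∫ ω, (if idx t ω = p then (1 : ℝ) else 0) ∂P = (Fintype.card ι : ℝ)⁻¹ := by
    intro p
    have h1 : (fun ω => if idx t ω = p then (1 : ℝ) else 0) =
        (idx t ⁻¹' {p}).indicator fun _ => 1 := by
      ext ω; simp [Set.indicator_apply]
    rw [h1, integral_indicator_const _ (hidx t (measurableSet_singleton p)), smul_eq_mul, mul_one,
      measureReal_def, ← Measure.map_apply (hidx t) (measurableSet_singleton p), hunif,
      uniformOn_univ]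
    simp
  have hterm : ∀ p, ∫ ω, Φ (fun j => idx j ω) p * (if idx t ω = p then (1 : ℝ) else 0) ∂P =
      (∫ ω, Φ (fun j => idx j ω) p ∂P) * (Fintype.card ι : ℝ)⁻¹ := by
    intro p
    have h1 : IndepFun (fun ω => Ψ (fun j => idx j ω) p)
        (fun ω => if idx t ω = p then (1 : ℝ) else 0) P :=
      hind2.comp (φ := fun u => Ψ u p)
        (ψ := fun u : ({t} : Finset ℕ) → ι => if u ⟨t, by simp⟩ = p then (1 : ℝ) else 0)
        (measurable_of_countable _) (measurable_of_countable _)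
    have hH : Measurable fun ω => fun j : Finset.range t => idx j ω :=
      measurable_pi_lambda _ fun j => hidx j
    have h2 : Measurable fun ω => Ψ (fun j => idx j ω) p :=
      (measurable_of_countable fun u => Ψ u p).comp hH
    have h3 : Measurable fun ω => if idx t ω = p then (1 : ℝ) else 0 :=
      (measurable_of_countable fun q : ι => if q = p then (1 : ℝ) else 0).comp (hidx t)
    simp only [hΨ]
    rw [h1.integral_fun_mul_eq_mul_integral h2.aestronglyMeasurable h3.aestronglyMeasurable, hprob]
  have hsplit : ∀ ω, Φ (fun j => idx j ω) (idx t ω) =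
      ∑ p, Φ (fun j => idx j ω) p * (if idx t ω = p then (1 : ℝ) else 0) := by
    intro ω; simp
  simp only [hsplit]
  rw [integral_finsetSum]
  · simp only [hterm, ← Finset.sum_mul, div_eq_mul_inv]
  · intro p _
    exact integrable_history hidx (t + 1)
      (fun x => Φ x p * if x t = p then (1 : ℝ) else 0) fun x y h => by
        rw [hΦ x y fun j hj => h j (by omega), h t (by omega)]

/-- If the potential satisfies an averaged recursive inequality on the good set, its killed
expectation satisfies the same inequality. -/
lemma integral_stopped_succ_le (hidx : ∀ t, Measurable (idx t))
    (hunif : ∀ t, P.map (idx t) = uniformOn Set.univ) (hind : iIndepFun idx P)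
    {good : ℕ → S → Prop} {V : ℕ → S → ℝ} {step : S → ι → S} {x₀ : S}
    {x : (ℕ → ι) → ℕ → S} (hx0 : ∀ u, x u 0 = x₀)
    (hx : ∀ u t, x u (t + 1) = step (x u t) (u t)) (hV : ∀ t X, 0 ≤ V t X) {t : ℕ} {a b : ℝ}
    (ha : 0 ≤ a) (hb : 0 ≤ b)
    (hstep : ∀ X, good t X → ∑ p, V (t + 1) (step X p) ≤ Fintype.card ι * (a * V t X + b)) :
    ∫ ω, stopped good V x (t + 1) (fun j => idx j ω) ∂P ≤
      a * ∫ ω, stopped good V x t (fun j => idx j ω) ∂P + b := by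
  classical
  set Φ : (ℕ → ι) → ι → ℝ := fun u p =>
    if ∀ j < t + 1, good j (x u j) then V (t + 1) (step (x u t) p) else 0 with hΦd
  have hΦ : ∀ u v, (∀ j < t, u j = v j) → Φ u = Φ v := by
    intro u v h
    have h1 : ∀ j ≤ t, x u j = x v j := fun j hj =>
      chain_congr hx0 hx fun i hi => h i (by omega)
    have h2 : (∀ j < t + 1, good j (x u j)) ↔ ∀ j < t + 1, good j (x v j) :=
      forall₂_congr fun j hj => by rw [h1 j (by omega)]
    ext p
    simp only [hΦd, h2, h1 t le_rfl]
  have h1 : ∀ u, stopped good V x (t + 1) u = Φ u (u t) := by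
    intro u
    simp only [stopped, hΦd, hx]
  have hint : ∀ p, Integrable (fun ω => Φ (fun j => idx j ω) p) P := fun p =>
    integrable_history hidx t (fun u => Φ u p) fun u v h => congrFun (hΦ u v h) p
  have hints : Integrable (fun ω => stopped good V x t (fun j => idx j ω)) P :=
    integrable_history hidx t _ (stopped_congr hx0 hx t)
  obtain ⟨ω₀⟩ : Nonempty Ω := P.nonempty_of_neZero
  have hcard : (0 : ℝ) < Fintype.card ι := by
    have : Nonempty ι := ⟨idx 0 ω₀⟩
    exact_mod_cast Fintype.card_pos
  simp only [h1]
  rw [integral_eq_average hidx hunif hind t Φ hΦ, ← integral_finsetSum _ fun p _ => hint p,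
    div_le_iff₀ hcard]
  have h2 : (a * ∫ ω, stopped good V x t (fun j => idx j ω) ∂P + b) * Fintype.card ι =
      ∫ ω, (a * stopped good V x t (fun j => idx j ω) + b) * Fintype.card ι ∂P := by
    rw [integral_mul_const, integral_add (hints.const_mul a) (integrable_const b),
      integral_const_mul]
    simp
  rw [h2]
  refine integral_mono (integrable_finsetSum _ fun p _ => hint p)
    (((hints.const_mul a).add (integrable_const b)).mul_const _) fun ω => ?_
  by_cases hg : ∀ j < t + 1, good j (x (fun j => idx j ω) j)
  · have h3 : ∀ p, Φ (fun j => idx j ω) p = V (t + 1) (step (x (fun j => idx j ω) t) p) :=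
      fun p => if_pos hg
    simp only [h3]
    rw [stopped_of_good fun j hj => hg j (by omega), mul_comm]
    exact hstep _ (hg t (by omega))
  · have h3 : ∀ p, Φ (fun j => idx j ω) p = 0 := fun p => if_neg hg
    have := stopped_nonneg (good := good) hV x t (fun j => idx j ω)
    simp only [h3, Finset.sum_const_zero]
    positivity

/-- Markov's inequality for the killed potential. -/
lemma measureReal_stopped_le (hidx : ∀ t, Measurable (idx t))
    {good : ℕ → S → Prop} {V : ℕ → S → ℝ} {step : S → ι → S} {x₀ : S}
    {x : (ℕ → ι) → ℕ → S} (hx0 : ∀ u, x u 0 = x₀)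
    (hx : ∀ u t, x u (t + 1) = step (x u t) (u t)) (hV : ∀ t X, 0 ≤ V t X) {t : ℕ} {A B : ℝ}
    (hA : 0 < A) (hB : ∫ ω, stopped good V x t (fun j => idx j ω) ∂P ≤ B) :
    P.real {ω | (∀ j < t, good j (x (fun j => idx j ω) j)) ∧
      A ≤ V t (x (fun j => idx j ω) t)} ≤ B / A := by
  have hints : Integrable (fun ω => stopped good V x t (fun j => idx j ω)) P :=
    integrable_history hidx t _ (stopped_congr hx0 hx t)
  have h := mul_meas_ge_le_integral_of_nonneg
    (Filter.Eventually.of_forall fun ω => stopped_nonneg (good := good) hV x t (fun j => idx j ω))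
    hints A
  rw [le_div_iff₀ hA, mul_comm]
  refine le_trans (mul_le_mul_of_nonneg_left (measureReal_mono ?_) hA.le) (h.trans hB)
  rintro ω ⟨h1, h2⟩
  rw [Set.mem_ofPred_eq, stopped_of_good h1]
  exact h2

end Chain

/-! ### High-probability bounds -/

section HighProbability

variable {d r : ℕ} {Z X₀ : Matrix (Fin d) (Fin r) ℝ} {ρ α : ℝ} {Ω : Type*} [MeasurableSpace Ω]
  {P : Measure Ω} [IsProbabilityMeasure P] {idx : ℕ → Ω → Fin d × Fin d}

/-- The bounds claimed for the iterate at time `t`. -/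
def Good (Z : Matrix (Fin d) (Fin r) ℝ) (ρ α : ℝ) (t : ℕ) (X : Matrix (Fin d) (Fin r) ℝ) : Prop :=
  f Z X ≤ (1 - α / 2) ^ t * fMax Z ρ ∧ ∀ i, g X i ≤ gMax Z ρ

lemma fMax_nonneg (Z : Matrix (Fin d) (Fin r) ℝ) (ρ : ℝ) : 0 ≤ fMax Z ρ := sq_nonneg _

lemma Good.nearTruth (hZ : (Z * Zᵀ).rank = r) (hσ : sigmaMax Z = 1) (hρ : 0 ≤ ρ)
    (hρ1 : ρ < 1 / 2) (hα : 0 < α) (hα1 : α ≤ 1) {t : ℕ} {X : Matrix (Fin d) (Fin r) ℝ}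
    (h : Good Z ρ α t X) : NearTruth Z X (kappa Z)⁻¹ ρ √(gMax Z ρ) :=
  nearTruth_of_le hZ hσ hρ hρ1 (h.1.trans (mul_le_of_le_one_left (fMax_nonneg Z ρ)
    (pow_le_one₀ (by linarith) (by linarith)))) h.2

lemma card_index : (Fintype.card (Fin d × Fin d) : ℝ) = (d : ℝ) ^ 2 := by
  simp [sq]

/-- The objective exceeds its level with probability at most `2⁻ⁿ`, by the moment of order `n`. -/
lemma measureReal_f_large_le (hidx : ∀ t, Measurable (idx t))
    (hunif : ∀ t, P.map (idx t) = uniformOn Set.univ) (hind : iIndepFun idx P)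
    (hZ : (Z * Zᵀ).rank = r) (hσ : sigmaMax Z = 1) (hρ : 0 ≤ ρ) (hρ1 : ρ < 1 / 2)
    (hf : f Z X₀ ≤ 1 / 2 * fMax Z ρ) (hF : 0 < fMax Z ρ) (hα : 0 < α) (hα1 : α ≤ 1) {n : ℕ}
    (hn : 1 ≤ n) (hβ : 4096 * (n * (α * (d : ℝ) ^ 2 * gMax Z ρ)) ≤ 1) (t : ℕ) :
    P.real {ω | (∀ j < t, Good Z ρ α j (iterate Z α X₀ (fun j => idx j ω) j)) ∧
      (1 - α / 2) ^ t * fMax Z ρ ≤ f Z (iterate Z α X₀ (fun j => idx j ω) t)} ≤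
        (1 / 2) ^ n := by
  set F := fMax Z ρ
  have hq : 0 < 1 - α / 2 := by linarith
  have hV : ∀ (_ : ℕ) (X : Matrix (Fin d) (Fin r) ℝ), 0 ≤ f Z X ^ n := fun _ X =>
    pow_nonneg (f_nonneg Z X) n
  have hM : ∀ t, ∫ ω, stopped (Good Z ρ α) (fun _ X => f Z X ^ n) (iterate Z α X₀) t
      (fun j => idx j ω) ∂P ≤ ((1 - α / 2) ^ t * (1 / 2 * F)) ^ n := by
    intro t
    induction t with
    | zero =>
      have : ∀ u, stopped (Good Z ρ α) (fun _ X => f Z X ^ n) (iterate Z α X₀) 0 u =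
          f Z X₀ ^ n := fun u => stopped_of_good (by simp)
      simp only [this, integral_const, probReal_univ, one_smul, pow_zero, one_mul]
      exact pow_le_pow_left₀ (f_nonneg _ _) hf n
    | succ t ih =>
      have h := integral_stopped_succ_le (P := P) hidx hunif hind (good := Good Z ρ α)
        (V := fun _ X => f Z X ^ n) (step := update Z α) (x₀ := X₀) (x := iterate Z α X₀)
        (fun _ => rfl) (fun _ _ => rfl) hV (t := t) (a := (1 - α / 2) ^ n) (b := 0)
        (by positivity) le_rfl (fun X hX => by
          rw [card_index, add_zero]
          refine (hX.nearTruth hZ hσ hρ hρ1 hα hα1).sum_f_update_pow_le hα hn ?_ hα1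
          rwa [Real.sq_sqrt (gMax_pos hZ hσ hρ hρ1).le])
      refine h.trans ?_
      rw [add_zero]
      refine (mul_le_mul_of_nonneg_left ih (by positivity)).trans_eq ?_
      rw [← mul_pow, pow_succ', mul_assoc]
  have hA : 0 < ((1 - α / 2) ^ t * F) ^ n := by positivity
  have h := measureReal_stopped_le (P := P) hidx (step := update Z α) (x₀ := X₀)
    (x := iterate Z α X₀) (fun _ => rfl) (fun _ _ => rfl) hV hA (hM t)
  have e : ((1 - α / 2) ^ t * (1 / 2 * F)) ^ n / ((1 - α / 2) ^ t * F) ^ n = (1 / 2) ^ n := by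
    rw [← div_pow, mul_div_mul_left _ _ (pow_pos hq t).ne', mul_div_assoc, div_self hF.ne', mul_one]
  rw [e] at h
  refine (measureReal_mono ?_).trans h
  rintro ω ⟨h1, h2⟩
  exact ⟨h1, pow_le_pow_left₀ (by positivity) h2 n⟩

/-- The coherence of row `i` exceeds its level with small probability. The noise of a step is
proportional to the objective, which decays geometrically, so its total effect is bounded by
`2 D` with `D = 1536 θ² α d² ρ²`. -/
lemma measureReal_g_large_le (hidx : ∀ t, Measurable (idx t))
    (hunif : ∀ t, P.map (idx t) = uniformOn Set.univ) (hind : iIndepFun idx P)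
    (hZ : (Z * Zᵀ).rank = r) (hσ : sigmaMax Z = 1) (hρ : 0 ≤ ρ) (hρ1 : ρ < 1 / 2)
    (hg : ∀ i, g X₀ i ≤ 1 / 2 * gMax Z ρ) (hα : 0 < α) (hα1 : α ≤ 1 / 4) {θ : ℝ}
    (hθ : 1 ≤ θ) (hτ : 32 * (θ * (α * (d : ℝ) ^ 2 * ρ)) ≤ 1) (i : Fin d) (t : ℕ) :
    P.real {ω | (∀ j < t, Good Z ρ α j (iterate Z α X₀ (fun j => idx j ω) j)) ∧
      gMax Z ρ ≤ g (iterate Z α X₀ (fun j => idx j ω) t) i} ≤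
        Real.exp (2 * (1536 * θ ^ 2 * (α * (d : ℝ) ^ 2 * ρ ^ 2)) - θ / 2) := by
  have hgm := gMax_pos hZ hσ hρ hρ1
  set s := √(gMax Z ρ) with hs
  have hs2 : s ^ 2 = gMax Z ρ := Real.sq_sqrt hgm.le
  set D := 1536 * θ ^ 2 * (α * (d : ℝ) ^ 2 * ρ ^ 2) with hD
  have hD0 : 0 ≤ D := by positivity
  set ε := 4 * (1 - 2 * ρ) / (1 - ρ) * α with hε
  have hε0 : 0 ≤ ε := mul_nonneg (div_nonneg (by linarith) (by linarith)) hα.le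
  have hε1 : ε ≤ 1 := by
    have h1 : 4 * (1 - 2 * ρ) / (1 - ρ) ≤ 4 := by
      rw [div_le_iff₀ (by linarith)]; linarith
    calc ε ≤ 4 * (1 / 4) := mul_le_mul h1 hα1 hα.le (by norm_num)
      _ = 1 := by norm_num
  have hq : 0 ≤ 1 - α / 2 := by linarith
  have hV : ∀ (_ : ℕ) (X : Matrix (Fin d) (Fin r) ℝ), 0 ≤ cohPot θ s i X := fun _ X =>
    Real.exp_nonneg _
  have hM : ∀ t, ∫ ω, stopped (Good Z ρ α) (fun _ => cohPot θ s i) (iterate Z α X₀) t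
      (fun j => idx j ω) ∂P ≤
        Real.exp (θ * (7 / 16) + 2 * D * (1 - (1 - α / 2) ^ t)) := by
    intro t
    induction t with
    | zero =>
      have : ∀ u, stopped (Good Z ρ α) (fun _ => cohPot θ s i) (iterate Z α X₀) 0 u =
          cohPot θ s i X₀ := fun u => stopped_of_good (by simp)
      simp only [this, integral_const, probReal_univ, one_smul, pow_zero, sub_self, mul_zero,
        add_zero, cohPot]
      refine Real.exp_le_exp.2 (mul_le_mul_of_nonneg_left ?_ (by linarith))
      have : g X₀ i / s ^ 2 ≤ 1 / 2 := by
        rw [hs2, div_le_iff₀ hgm]; exact hg i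
      linarith
    | succ t ih =>
      have hqt : 0 ≤ (1 - α / 2) ^ t := pow_nonneg hq t
      have h := integral_stopped_succ_le (P := P) hidx hunif hind (good := Good Z ρ α)
        (V := fun _ => cohPot θ s i) (step := update Z α) (x₀ := X₀) (x := iterate Z α X₀)
        (fun _ => rfl) (fun _ _ => rfl) hV (t := t)
        (a := 1 - ε + D * α * (1 - α / 2) ^ t) (b := ε)
        (by have : 0 ≤ D * α * (1 - α / 2) ^ t := by positivity
            linarith) hε0 (fun X hX => by
          have h2 := (hX.nearTruth hZ hσ hρ hρ1 hα (by linarith)).sum_cohPot_update_le hα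
            hθ hτ (q := (1 - α / 2) ^ t) (by rw [← fMax_eq]; exact hX.1) i
          rw [card_index]
          refine h2.trans_eq ?_
          rw [hD]; ring)
      refine h.trans ?_
      set M := Real.exp (θ * (7 / 16) + 2 * D * (1 - (1 - α / 2) ^ t)) with hMd
      have hM1 : 1 ≤ M := by
        refine Real.one_le_exp ?_
        have h1 : (1 - α / 2) ^ t ≤ 1 := pow_le_one₀ hq (by linarith)
        have h2 : 0 ≤ 2 * D * (1 - (1 - α / 2) ^ t) :=
          mul_nonneg (by linarith) (by linarith)
        linarith
      have hδ : 0 ≤ D * α * (1 - α / 2) ^ t := by positivity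
      have h1 : Real.exp (θ * (7 / 16) + 2 * D * (1 - (1 - α / 2) ^ (t + 1))) =
          M * Real.exp (D * α * (1 - α / 2) ^ t) := by
        rw [hMd, ← Real.exp_add]; congr 1; ring
      rw [h1]
      calc _ ≤ (1 - ε + D * α * (1 - α / 2) ^ t) * M + ε := by
            have := mul_le_mul_of_nonneg_left ih
              (by linarith : 0 ≤ 1 - ε + D * α * (1 - α / 2) ^ t)
            linarith
        _ ≤ M * (D * α * (1 - α / 2) ^ t + 1) := by nlinarith
        _ ≤ _ := mul_le_mul_of_nonneg_left (Real.add_one_le_exp _) (by linarith)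
  have h := measureReal_stopped_le (P := P) hidx (step := update Z α) (x₀ := X₀)
    (x := iterate Z α X₀) (fun _ => rfl) (fun _ _ => rfl) hV (Real.exp_pos (θ * (15 / 16)))
    (hM t)
  have h' : Real.exp (θ * (7 / 16) + 2 * D * (1 - (1 - α / 2) ^ t)) / Real.exp (θ * (15 / 16)) ≤
      Real.exp (2 * D - θ / 2) := by
    rw [← Real.exp_sub]
    refine Real.exp_le_exp.2 ?_
    have : 0 ≤ 2 * D * (1 - α / 2) ^ t := by positivity
    linarith
  refine (measureReal_mono ?_).trans (h.trans h')
  rintro ω ⟨h1, h2⟩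
  refine ⟨h1, Real.exp_le_exp.2 (mul_le_mul_of_nonneg_left ?_ (by linarith))⟩
  have : 1 ≤ g (iterate Z α X₀ (fun j => idx j ω) t) i / s ^ 2 := by
    rw [hs2, le_div_iff₀ hgm, one_mul]; exact h2
  linarith

lemma exp_neg_mul_log (hd : 0 < d) (k : ℕ) :
    Real.exp (-(k * Real.log d)) = ((d : ℝ) ^ k)⁻¹ := by
  have : (0 : ℝ) < d := by exact_mod_cast hd
  rw [Real.exp_neg, Real.exp_nat_mul, Real.exp_log this]

/-- If the initial objective vanishes, the iterates never move. -/
lemma iterate_eq_of_f_eq_zero (h : f Z X₀ = 0) (u : ℕ → Fin d × Fin d) (t : ℕ) :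
    iterate Z α X₀ u t = X₀ := by
  have hE : ∀ p : Fin d × Fin d, err Z X₀ p.1 p.2 = 0 := by
    have h1 := sum_err_sq Z X₀
    rw [h, Finset.sum_eq_zero_iff_of_nonneg fun _ _ => sq_nonneg _] at h1
    exact fun p => pow_eq_zero_iff two_ne_zero |>.1 (h1 p (Finset.mem_univ p))
  induction t with
  | zero => rfl
  | succ t ih =>
    change update Z α (iterate Z α X₀ u t) (u t) = X₀
    rw [ih, update_eq_mul_gram_inv, stepSize, hE]
    simp

/-- The first exit from the good set happens at a given time with probability at most `d⁻¹⁰`. -/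
lemma measureReal_exit_le (hidx : ∀ t, Measurable (idx t))
    (hunif : ∀ t, P.map (idx t) = uniformOn Set.univ) (hind : iIndepFun idx P)
    (hZ : (Z * Zᵀ).rank = r) (hσ : sigmaMax Z = 1) (hρ : 0 ≤ ρ) (hρ1 : ρ < 1 / 2)
    (hf : f Z X₀ ≤ 1 / 2 * fMax Z ρ) (hF : 0 < fMax Z ρ)
    (hg : ∀ i, g X₀ i ≤ 1 / 2 * gMax Z ρ) (hα : 0 < α) (hd : 2 ≤ d)
    (hc : α * ((gMax Z ρ + ρ) * (d : ℝ) ^ 2 * Real.log d) < 1 / 10 ^ 6) (t : ℕ) :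
    P.real {ω | (∀ j < t, Good Z ρ α j (iterate Z α X₀ (fun j => idx j ω) j)) ∧
      ¬ Good Z ρ α t (iterate Z α X₀ (fun j => idx j ω) t)} ≤ 1 / (d : ℝ) ^ 10 := by
  have hgm := gMax_pos hZ hσ hρ hρ1
  have hd2 : (2 : ℝ) ≤ d := by exact_mod_cast hd
  set L := Real.log d with hL
  have hL1 : 0.69 ≤ L := by
    have h1 := Real.log_two_gt_d9
    have h2 : Real.log 2 ≤ L := Real.log_le_log (by norm_num) hd2
    linarith
  have hg0 : 0 ≤ α * (d : ℝ) ^ 2 * gMax Z ρ := by positivity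
  have hr0 : 0 ≤ α * (d : ℝ) ^ 2 * ρ := by positivity
  have hgL : α * (d : ℝ) ^ 2 * gMax Z ρ * L ≤ 1 / 10 ^ 6 := by
    have : 0 ≤ α * (d : ℝ) ^ 2 * ρ * L := mul_nonneg hr0 (by linarith)
    linarith
  have hrL : α * (d : ℝ) ^ 2 * ρ * L ≤ 1 / 10 ^ 6 := by
    have : 0 ≤ α * (d : ℝ) ^ 2 * gMax Z ρ * L := mul_nonneg hg0 (by linarith)
    linarith
  have hα1 : α ≤ 1 / 4 := by
    have h1 := sixteen_le_mul_gMax hZ hσ hρ hρ1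
    have h2 : 32 * α ≤ α * (d : ℝ) ^ 2 * gMax Z ρ := by
      have h3 : 2 * 16 ≤ (d : ℝ) * (d * gMax Z ρ) :=
        mul_le_mul hd2 h1 (by norm_num) (by linarith)
      have := mul_le_mul_of_nonneg_left h3 hα.le
      linarith
    have h3 := mul_le_mul_of_nonneg_left hL1 hg0
    linarith
  -- the moment of order about `18 log d` for the objective
  set n := ⌈18 * L⌉₊ with hn
  have hn1 : 18 * L ≤ n := Nat.le_ceil _
  have hn2 : (n : ℝ) ≤ 20 * L := by
    have := Nat.ceil_lt_add_one (by linarith : 0 ≤ 18 * L)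
    linarith
  have hn0 : 1 ≤ n := Nat.one_le_iff_ne_zero.2 fun h0 => by
    rw [h0, Nat.cast_zero] at hn1; linarith
  have hpf := measureReal_f_large_le (P := P) hidx hunif hind hZ hσ hρ hρ1 hf hF hα
    (by linarith) hn0 (by
      have := mul_le_mul_of_nonneg_right hn2 hg0
      linarith) t
  have hpf2 : (1 / 2 : ℝ) ^ n ≤ ((d : ℝ) ^ 12)⁻¹ := by
    rw [← exp_neg_mul_log (by omega) 12, ← hL]
    have h1 : (1 / 2 : ℝ) ^ n = Real.exp (n * -Real.log 2) := by
      rw [Real.exp_nat_mul, Real.exp_neg, Real.exp_log (by norm_num)]; norm_num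
    rw [h1]
    refine Real.exp_le_exp.2 ?_
    have h2 := Real.log_two_gt_d9
    have h3 : 18 * L * 0.69 ≤ n * Real.log 2 :=
      mul_le_mul hn1 (by linarith) (by norm_num) (by positivity)
    push_cast
    linarith
  -- the exponential moment with parameter `32 log d` for the coherence
  have hpg : ∀ i, P.real {ω | (∀ j < t, Good Z ρ α j (iterate Z α X₀ (fun j => idx j ω) j)) ∧
      gMax Z ρ ≤ g (iterate Z α X₀ (fun j => idx j ω) t) i} ≤ ((d : ℝ) ^ 13)⁻¹ := by
    intro i
    refine (measureReal_g_large_le (P := P) hidx hunif hind hZ hσ hρ hρ1 hg hα hα1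
      (θ := 32 * L) (by linarith) (by linarith) i t).trans ?_
    rw [← exp_neg_mul_log (by omega) 13, ← hL]
    refine Real.exp_le_exp.2 ?_
    have h1 : α * (d : ℝ) ^ 2 * ρ * L * (ρ * L) ≤ 1 / 10 ^ 6 * (1 / 2 * L) :=
      mul_le_mul hrL (mul_le_mul_of_nonneg_right hρ1.le (by linarith))
        (mul_nonneg hρ (by linarith)) (by norm_num)
    push_cast
    linarith
  have hsub : {ω | (∀ j < t, Good Z ρ α j (iterate Z α X₀ (fun j => idx j ω) j)) ∧
      ¬ Good Z ρ α t (iterate Z α X₀ (fun j => idx j ω) t)} ⊆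
      {ω | (∀ j < t, Good Z ρ α j (iterate Z α X₀ (fun j => idx j ω) j)) ∧
        (1 - α / 2) ^ t * fMax Z ρ ≤ f Z (iterate Z α X₀ (fun j => idx j ω) t)} ∪
      ⋃ i, {ω | (∀ j < t, Good Z ρ α j (iterate Z α X₀ (fun j => idx j ω) j)) ∧
        gMax Z ρ ≤ g (iterate Z α X₀ (fun j => idx j ω) t) i} := by
    rintro ω ⟨h1, h2⟩
    rw [Good, not_and_or, not_le, not_forall] at h2
    rcases h2 with h2 | ⟨i, h2⟩
    · exact Or.inl ⟨h1, h2.le⟩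
    · exact Or.inr (Set.mem_iUnion.2 ⟨i, h1, (not_le.1 h2).le⟩)
  have hU := measureReal_iUnion_fintype_le (μ := P) fun i =>
    {ω | (∀ j < t, Good Z ρ α j (iterate Z α X₀ (fun j => idx j ω) j)) ∧
        gMax Z ρ ≤ g (iterate Z α X₀ (fun j => idx j ω) t) i}
  have hU2 := hU.trans (Finset.sum_le_sum fun i _ => hpg i)
  rw [Finset.sum_const, Finset.card_univ, Fintype.card_fin, nsmul_eq_mul] at hU2
  refine (measureReal_mono hsub).trans ((measureReal_union_le _ _).trans
    ((add_le_add (hpf.trans hpf2) hU2).trans ?_))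
  have hd0 : (d : ℝ) ≠ 0 := by positivity
  have e : ((d : ℝ) ^ 12)⁻¹ + d * ((d : ℝ) ^ 13)⁻¹ = 2 / (d : ℝ) ^ 2 * (1 / (d : ℝ) ^ 10) := by
    field_simp; norm_num
  rw [e]
  refine mul_le_of_le_one_left (by positivity) ?_
  rw [div_le_one (by positivity)]
  nlinarith

end HighProbability

end ScaledSGD

theorem theorem2 :
    ∃ c : ℝ, 0 < c ∧
      ∀ (d r : ℕ) (Z X₀ : Matrix (Fin d) (Fin r) ℝ) (ρ α : ℝ) (T : ℕ)
        (Ω : Type*) [MeasurableSpace Ω] (P : Measure Ω) [IsProbabilityMeasure P]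
        (idx : ℕ → Ω → Fin d × Fin d),
        -- the samples are independent and uniform on `[d] × [d]`
        (∀ t, Measurable (idx t)) →
        (∀ t, P.map (idx t) = uniformOn Set.univ) →
        iIndepFun idx P →
        -- the ground truth has rank exactly `r` and is normalized
        (Z * Zᵀ).rank = r →
        ScaledSGD.sigmaMax Z = 1 →
        -- the radius and the initial point
        0 ≤ ρ → ρ < 1 / 2 →
        ScaledSGD.f Z X₀ ≤ 1 / 2 * ScaledSGD.fMax Z ρ →
        (∀ i, ScaledSGD.g X₀ i ≤ 1 / 2 * ScaledSGD.gMax Z ρ) →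
        -- the step size, `α < c / ((g_max + ρ) d² log d)`
        0 < α →
        α * ((ScaledSGD.gMax Z ρ + ρ) * (d : ℝ) ^ 2 * Real.log d) < c →
        1 - (T : ℝ) / (d : ℝ) ^ 10 ≤
          P.real {ω | ∀ t ≤ T,
            ScaledSGD.f Z (ScaledSGD.iterate Z α X₀ (fun s => idx s ω) t) ≤
                (1 - α / 2) ^ t * ScaledSGD.fMax Z ρ ∧
              ∀ i, ScaledSGD.g (ScaledSGD.iterate Z α X₀ (fun s => idx s ω) t) i ≤
                ScaledSGD.gMax Z ρ} := by
  refine ⟨1 / 10 ^ 6, by norm_num, ?_⟩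
  intro d r Z X₀ ρ α T Ω _ P _ idx hidx hunif hind hZ hσ hρ hρ1 hf hg hα hc
  have hgm := ScaledSGD.gMax_pos hZ hσ hρ hρ1
  have hg0 : ∀ i, ScaledSGD.g X₀ i ≤ ScaledSGD.gMax Z ρ := fun i => by linarith [hg i]
  have hF0 := ScaledSGD.fMax_nonneg Z ρ
  change _ ≤ P.real {ω | ∀ t ≤ T, ScaledSGD.Good Z ρ α t
    (ScaledSGD.iterate Z α X₀ (fun s => idx s ω) t)}
  have hgood0 : ScaledSGD.Good Z ρ α 0 X₀ := ⟨by rw [pow_zero, one_mul]; linarith, hg0⟩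
  have hT0 : 0 ≤ (T : ℝ) / (d : ℝ) ^ 10 := by positivity
  rcases hF0.eq_or_lt with hF | hF
  · -- `fMax = 0`: the chain starts, and stays, at the ground truth
    have h0 : ScaledSGD.f Z X₀ = 0 :=
      le_antisymm (by rw [← hF] at hf; linarith) (ScaledSGD.f_nonneg _ _)
    have hall : {ω | ∀ t ≤ T, ScaledSGD.Good Z ρ α t
        (ScaledSGD.iterate Z α X₀ (fun s => idx s ω) t)} = Set.univ := by
      refine Set.eq_univ_of_forall fun ω t _ => ?_
      rw [ScaledSGD.iterate_eq_of_f_eq_zero h0]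
      exact ⟨by rw [h0, ← hF, mul_zero], hg0⟩
    rw [hall, probReal_univ]
    linarith
  rcases Nat.lt_or_ge d 2 with hd | hd
  · -- `d = 1`: the step size is unconstrained, and the bound is void as soon as `T ≥ 1`
    rcases Nat.eq_zero_or_pos T with hT | hT
    · have hall : {ω | ∀ t ≤ T, ScaledSGD.Good Z ρ α t
          (ScaledSGD.iterate Z α X₀ (fun s => idx s ω) t)} = Set.univ := by
        refine Set.eq_univ_of_forall fun ω t ht => ?_
        obtain rfl : t = 0 := by omega
        exact hgood0
      rw [hall, probReal_univ]
      linarith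
    · have hd1 : d = 1 := by
        have h := ScaledSGD.sixteen_le_mul_gMax hZ hσ hρ hρ1
        have : d ≠ 0 := by rintro rfl; norm_num at h
        omega
      subst hd1
      have : (1 : ℝ) ≤ T := by exact_mod_cast hT
      refine le_trans ?_ measureReal_nonneg
      simp only [Nat.cast_one, one_pow, div_one]
      linarith
  · have h := ScaledSGD.one_sub_le_measureReal_good (P := P) (good := ScaledSGD.Good Z ρ α)
      (fun t ω => ScaledSGD.iterate Z α X₀ (fun s => idx s ω) t) (T := T)
      (δ := 1 / (d : ℝ) ^ 10) (fun _ => hgood0) (fun t _ _ =>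
        ScaledSGD.measureReal_exit_le hidx hunif hind hZ hσ hρ hρ1 hf hF hg hα hd hc t)
    rwa [mul_one_div] at h
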